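/- Let $(M,g)$ be a compact connected smooth Riemannian manifold (without boundary) of dimension $n$, with Levi-Civita connection $\nabla$, whose Ricci tensor satisfies $\mathrm{Ric}(X,X)\ge (n-1)\,g(X,X)$ for all tangent vectors $X$. Let $\triangle f=-\mathrm{tr}^g\,\nabla^2 f$ be the non-negative Laplacian. If the lowest possible eigenvalue $n$ is achieved, i.e. there is a smooth function $f:M\to\mathbb R$, not identically zero, with $\triangle f=nf$, then $(M,g)$ is an Einstein space: there is a constant $c\in\mathbb R$ with $\mathrm{Ric}=c\,g$ on $M$. -/

import Mathlib

open Bundle VectorField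
open scoped Manifold ContDiff

noncomputable section

namespace RiemannianGeometry

section

variable {E : Type*} [NormedAddCommGroup E] [NormedSpace ℝ E] [FiniteDimensional ℝ E]
  {H : Type*} [TopologicalSpace H] {I : ModelWithCorners ℝ E H}
  {M : Type*} [TopologicalSpace M] [ChartedSpace H M] [IsManifold I ∞ M]
  [RiemannianBundle (fun x : M ↦ TangentSpace I x)]
  [IsContMDiffRiemannianBundle I ∞ E (fun x : M ↦ TangentSpace I x)]

instance finiteDimensional_tangentSpace (x : M) : FiniteDimensional ℝ (TangentSpace I x) :=
  inferInstanceAs (FiniteDimensional ℝ E)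

instance completeSpace_tangentSpace (x : M) : CompleteSpace (TangentSpace I x) :=
  FiniteDimensional.complete ℝ _

set_option linter.unusedSectionVars false

theorem mdiffAt_inner {X Y : Π x : M, TangentSpace I x} {x : M}
    (hX : MDiffAt (T% X) x) (hY : MDiffAt (T% Y) x) :
    MDiffAt (fun y : M ↦ inner ℝ (X y) (Y y)) x :=
  MDifferentiableAt.inner_bundle (IB := I) (F := E) (E := fun x : M ↦ TangentSpace I x) hX hY

/-- Half of the right-hand side of the Koszul formula
`2 g(∇_X Y, Z) = X g(Y,Z) + Y g(X,Z) - Z g(X,Y) + g([X,Y],Z) - g([X,Z],Y) - g([Y,Z],X)`. -/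
def koszul (Y X Z : Π x : M, TangentSpace I x) (x : M) : ℝ :=
  (1 / 2 : ℝ) *
    (d% (fun y : M ↦ inner ℝ (Y y) (Z y)) x (X x)
      + d% (fun y : M ↦ inner ℝ (X y) (Z y)) x (Y x)
      - d% (fun y : M ↦ inner ℝ (X y) (Y y)) x (Z x)
      + inner ℝ (mlieBracket I X Y x) (Z x)
      - inner ℝ (mlieBracket I X Z x) (Y x)
      - inner ℝ (mlieBracket I Y Z x) (X x))

theorem koszul_tensorial₁ {Y : Π x : M, TangentSpace I x} {x : M} (hY : MDiffAt (T% Y) x)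
    (Z : Π x : M, TangentSpace I x) (hZ : MDiffAt (T% Z) x) :
    TensorialAt I E (fun X ↦ koszul (I := I) Y X Z x) x where
  smul {f X} hf hX := by
    have h1 := mvfderiv_fun_mul hf (mdiffAt_inner hX hZ)
    have h2 := mvfderiv_fun_mul hf (mdiffAt_inner hX hY)
    simp [koszul, inner_smul_left, h1, h2, mlieBracket_smul_left hf hX, inner_add_left,
      inner_smul_right]
    ring
  add {X X'} hX hX' := by
    have h1 := mvfderiv_fun_add (mdiffAt_inner hX hZ) (mdiffAt_inner hX' hZ)
    have h2 := mvfderiv_fun_add (mdiffAt_inner hX hY) (mdiffAt_inner hX' hY)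
    simp [koszul, h1, h2, mlieBracket_add_left hX hX', inner_add_left, inner_add_right]
    ring

theorem koszul_tensorial₂ {Y : Π x : M, TangentSpace I x} {x : M} (hY : MDiffAt (T% Y) x)
    (X : Π x : M, TangentSpace I x) (hX : MDiffAt (T% X) x) :
    TensorialAt I E (fun Z ↦ koszul (I := I) Y X Z x) x where
  smul {f Z} hf hZ := by
    have h1 := mvfderiv_fun_mul hf (mdiffAt_inner hY hZ)
    have h2 := mvfderiv_fun_mul hf (mdiffAt_inner hX hZ)
    simp [koszul, inner_smul_left, h1, h2, mlieBracket_smul_right hf hZ, inner_add_left,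
      inner_smul_right]
    rw [real_inner_comm (X x) (Z x), real_inner_comm (Y x) (Z x)]
    ring
  add {Z Z'} hZ hZ' := by
    have h1 := mvfderiv_fun_add (mdiffAt_inner hY hZ) (mdiffAt_inner hY hZ')
    have h2 := mvfderiv_fun_add (mdiffAt_inner hX hZ) (mdiffAt_inner hX hZ')
    simp [koszul, h1, h2, mlieBracket_add_right hZ hZ', inner_add_left, inner_add_right]
    ring

theorem koszul_add {Y Y' X Z : Π x : M, TangentSpace I x} {x : M}
    (hY : MDiffAt (T% Y) x) (hY' : MDiffAt (T% Y') x)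
    (hX : MDiffAt (T% X) x) (hZ : MDiffAt (T% Z) x) :
    koszul (I := I) (Y + Y') X Z x = koszul (I := I) Y X Z x + koszul (I := I) Y' X Z x := by
  have h1 := mvfderiv_fun_add (mdiffAt_inner hY hZ) (mdiffAt_inner hY' hZ)
  have h2 := mvfderiv_fun_add (mdiffAt_inner hX hY) (mdiffAt_inner hX hY')
  simp [koszul, h1, h2, mlieBracket_add_right hY hY', mlieBracket_add_left hY hY',
    inner_add_left, inner_add_right]
  ring

theorem koszul_smul {Y X Z : Π x : M, TangentSpace I x} {f : M → ℝ} {x : M}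
    (hf : MDiffAt f x) (hY : MDiffAt (T% Y) x)
    (hX : MDiffAt (T% X) x) (hZ : MDiffAt (T% Z) x) :
    koszul (I := I) (f • Y) X Z x =
      f x * koszul (I := I) Y X Z x + d% f x (X x) * inner ℝ (Y x) (Z x) := by
  have h1 := mvfderiv_fun_mul hf (mdiffAt_inner hY hZ)
  have h2 := mvfderiv_fun_mul hf (mdiffAt_inner hX hY)
  simp [koszul, h1, h2, mlieBracket_smul_right hf hY, mlieBracket_smul_left hf hY,
    inner_add_left, inner_smul_left, inner_smul_right]
  rw [real_inner_comm (X x) (Y x)]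
  ring

/-- The endomorphism of the tangent space that represents a bilinear form through the metric:
`g(sharp B u, w) = B u w`. -/
def sharp {x : M} (B : TangentSpace I x →L[ℝ] TangentSpace I x →L[ℝ] ℝ) :
    TangentSpace I x →L[ℝ] TangentSpace I x :=
  LinearMap.toContinuousLinearMap
    { toFun := fun u ↦ (InnerProductSpace.toDual ℝ (TangentSpace I x)).symm (B u)
      map_add' := fun u v ↦ by simp
      map_smul' := fun c u ↦ by simp }

open Classical in
/-- `∇Y` at `x`, as the endomorphism `u ↦ ∇_u Y` of the tangent space which satisfies the Koszul
formula (and `0` if `Y` is not differentiable at `x`). -/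
def leviCivitaFun (Y : Π x : M, TangentSpace I x) (x : M) :
    TangentSpace I x →L[ℝ] TangentSpace I x :=
  if hY : MDiffAt (T% Y) x then
    sharp (TensorialAt.mkHom₂ (I := I) (F := E) (F' := E)
      (fun X Z ↦ koszul (I := I) Y X Z x) x (koszul_tensorial₁ hY) (koszul_tensorial₂ hY))
  else 0

theorem inner_leviCivitaFun {Y X Z : Π x : M, TangentSpace I x} {x : M}
    (hY : MDiffAt (T% Y) x) (hX : MDiffAt (T% X) x) (hZ : MDiffAt (T% Z) x) :
    inner ℝ (leviCivitaFun Y x (X x)) (Z x) = koszul (I := I) Y X Z x := by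
  rw [leviCivitaFun, dif_pos hY]
  simp only [sharp, LinearMap.coe_toContinuousLinearMap', LinearMap.coe_mk, AddHom.coe_mk,
    InnerProductSpace.toDual_symm_apply]
  exact TensorialAt.mkHom₂_apply _ _ hX hZ

theorem clm_ext_fields {x : M} {A B : TangentSpace I x →L[ℝ] TangentSpace I x}
    (h : ∀ X Z : Π x : M, TangentSpace I x, MDiffAt (T% X) x → MDiffAt (T% Z) x →
      inner ℝ (A (X x)) (Z x) = inner ℝ (B (X x)) (Z x)) : A = B := by
  ext1 u
  refine ext_inner_right ℝ fun w ↦ ?_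
  have := h (FiberBundle.extend E u) (FiberBundle.extend E w)
    (FiberBundle.mdifferentiableAt_extend I E u) (FiberBundle.mdifferentiableAt_extend I E w)
  simpa using this

variable (I M) in
/-- The Levi-Civita connection: `leviCivita I M Y x u` is `∇_u Y` at `x`. -/
def leviCivita : CovariantDerivative I E (fun x : M ↦ TangentSpace I x) where
  toFun := leviCivitaFun
  isCovariantDerivativeOnUniv :=
    { add := fun {Y Y' x} hY hY' _ ↦ by
        refine clm_ext_fields fun X Z hX hZ ↦ ?_
        rw [inner_leviCivitaFun (mdifferentiableAt_add_section hY hY') hX hZ,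
          koszul_add hY hY' hX hZ]
        simp [inner_add_left, inner_leviCivitaFun, hY, hY', hX, hZ]
      leibniz := fun {Y f x} hY hf _ ↦ by
        refine clm_ext_fields fun X Z hX hZ ↦ ?_
        rw [inner_leviCivitaFun (hf.smul_section hY) hX hZ, koszul_smul hf hY hX hZ]
        simp [inner_add_left, inner_smul_left, inner_leviCivitaFun, hY, hX, hZ] }

theorem leviCivita_torsion : (leviCivita I M).torsion = 0 := by
  rw [CovariantDerivative.torsion_eq_zero_iff]
  intro X Y x hX hY
  refine ext_inner_right ℝ fun w ↦ ?_
  have hZ := FiberBundle.mdifferentiableAt_extend I E w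
  have h1 := inner_leviCivitaFun hY hX hZ
  have h2 := inner_leviCivitaFun hX hY hZ
  rw [FiberBundle.extend_apply_self] at h1 h2
  rw [inner_sub_left]
  change inner ℝ (leviCivitaFun Y x (X x)) w - inner ℝ (leviCivitaFun X x (Y x)) w = _
  rw [h1, h2]
  simp only [koszul, FiberBundle.extend_apply_self]
  rw [mlieBracket_swap_apply (V := Y) (W := X), inner_neg_left]
  simp only [real_inner_comm]
  ring

theorem leviCivita_metric {X Y Z : Π x : M, TangentSpace I x} {x : M}
    (hX : MDiffAt (T% X) x) (hY : MDiffAt (T% Y) x) (hZ : MDiffAt (T% Z) x) :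
    d% (fun y : M ↦ inner ℝ (Y y) (Z y)) x (X x) =
      inner ℝ (leviCivita I M Y x (X x)) (Z x) + inner ℝ (Y x) (leviCivita I M Z x (X x)) := by
  have h1 := inner_leviCivitaFun hY hX hZ
  have h2 := inner_leviCivitaFun hZ hX hY
  change _ = inner ℝ (leviCivitaFun Y x (X x)) (Z x) + inner ℝ (Y x) (leviCivitaFun Z x (X x))
  rw [← real_inner_comm (Y x), h1, h2]
  simp only [koszul]
  rw [mlieBracket_swap_apply (V := Z) (W := Y), inner_neg_left]
  simp only [real_inner_comm]
  ring

variable (I) in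
/-- The gradient of `f`: `g(∇f, v) = df(v)`. -/
def gradient (f : M → ℝ) (x : M) : TangentSpace I x :=
  (InnerProductSpace.toDual ℝ (TangentSpace I x)).symm (d% f x)

variable (I) in
/-- The Hessian `∇²f(u, v) = g(∇_u ∇f, v)`. -/
def hessian (f : M → ℝ) (x : M) (u v : TangentSpace I x) : ℝ :=
  inner ℝ (leviCivita I M (gradient I f) x u) v

/-- The metric trace `∑ B(eᵢ, eᵢ)` of a bilinear form, over an orthonormal basis of `T_x M`. -/
def metricTrace {x : M} (B : TangentSpace I x → TangentSpace I x → ℝ) : ℝ :=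
  ∑ i, B (stdOrthonormalBasis ℝ (TangentSpace I x) i) (stdOrthonormalBasis ℝ (TangentSpace I x) i)

variable (I) in
/-- The non-negative Laplacian `Δf = -tr ∇²f`. -/
def laplacian (f : M → ℝ) (x : M) : ℝ :=
  -metricTrace (hessian I f x)

/-- The curvature `R(X, Y)Z = ∇_X ∇_Y Z - ∇_Y ∇_X Z - ∇_[X, Y] Z` on vector fields. -/
def curvature (X Y Z : Π x : M, TangentSpace I x) (x : M) : TangentSpace I x :=
  leviCivita I M (fun y ↦ leviCivita I M Z y (Y y)) x (X x)
    - leviCivita I M (fun y ↦ leviCivita I M Z y (X y)) x (Y x)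
    - leviCivita I M Z x (mlieBracket I X Y x)

/-- The curvature tensor at `x`, computed on the extensions of tangent vectors at `x` to vector
fields that are smooth near `x` (its value does not depend on the extensions). -/
def curvatureAt (x : M) (u v w : TangentSpace I x) : TangentSpace I x :=
  curvature (I := I) (FiberBundle.extend E u) (FiberBundle.extend E v) (FiberBundle.extend E w) x

/-- The Ricci tensor `Ric(v, w) = tr (u ↦ R(u, v)w)`. -/
def ricci (x : M) (v w : TangentSpace I x) : ℝ :=
  metricTrace fun u u' : TangentSpace I x ↦ inner ℝ (curvatureAt x u v w) u'

variable (I M) in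
/-- `(M, g)` is an Einstein space: `Ric = c g` with a constant `c`. -/
def IsEinstein : Prop :=
  ∃ c : ℝ, ∀ (x : M) (v w : TangentSpace I x), ricci x v w = c * inner ℝ v w

end

end RiemannianGeometry

end

open Set Filter Topology

noncomputable section

namespace RiemannianGeometry

/-! ### Bilinear forms and traces in orthonormal bases. -/

section LinearAlgebra

variable {V : Type*} [NormedAddCommGroup V] [InnerProductSpace ℝ V] {ι : Type*} [Fintype ι]

/-! Write `V = ∇f` and `P = |∇f|² + f²`. Bochner's formula for `Δf = nf`
(`laplacian_norm_sq_add_sq`) reads `ΔP = -2 (Ric(V,V) - (n-1)|V|² + |∇²f + f g|²)`, and the Ricci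
bound makes this `≤ 0`. With the sign convention of `Δ`, `P` is subharmonic on a closed connected
manifold, so it is a constant `c` by the strong maximum principle (`eq_of_laplacian_nonpos`, by
Hopf's barrier argument). Both nonnegative terms then vanish, and `∇²f = -f g` (`hessian_rigidity`).

This equation makes the curvature equal to that of the unit sphere whenever one slot is `V`. The
second Bianchi identity then gives `∇_V R = 2f (R - R₁)`, with `R₁` the curvature tensor of the unit
sphere (`cov_gradient_curvature`). Tracing twice, the excess `s = scal - n(n-1)`, nonnegative by the
Ricci bound, satisfies `V s = 2 f s` (`dir_gradient_scalarCurvature`).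

Since `|V|² = c - f²` satisfies `V|V|² = -2f|V|²`, the product `s|V|²` is constant along `V`, and `Ψ
= s|V|²e^f` has `VΨ = s|V|⁴e^f`. At a maximum of `Ψ` this derivative is zero, so `Ψ` vanishes there
and hence everywhere. Thus `s = 0` wherever `V ≠ 0`, and the rest follows by continuity, because `V`
vanishes on no nonempty open set unless `f = 0`. Finally `Ric - (n-1)g` is nonnegative with trace `s
= 0`, so it is zero (`ricci_eq_of_hessian_eq`). No comparison with the sphere is needed. -/

theorem span_eq_top_of_orthonormal [FiniteDimensional ℝ V] {e : ι → V} (he : Orthonormal ℝ e)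
    (hc : Fintype.card ι = Module.finrank ℝ V) : ⊤ ≤ Submodule.span ℝ (range e) := by
  rw [he.linearIndependent.span_eq_top_of_card_eq_finrank' hc]

theorem sum_inner_smul_eq [FiniteDimensional ℝ V] {e : ι → V} (he : Orthonormal ℝ e)
    (hc : Fintype.card ι = Module.finrank ℝ V) (v : V) : ∑ i, inner ℝ v (e i) • e i = v := by
  have h := (OrthonormalBasis.mk he (span_eq_top_of_orthonormal he hc)).sum_repr v
  simpa [OrthonormalBasis.repr_apply_apply, real_inner_comm] using h

theorem sum_inner_mul_inner_eq [FiniteDimensional ℝ V] {e : ι → V} (he : Orthonormal ℝ e)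
    (hc : Fintype.card ι = Module.finrank ℝ V) (v w : V) :
    ∑ i, inner ℝ v (e i) * inner ℝ (e i) w = inner ℝ v w := by
  conv_rhs => rw [← sum_inner_smul_eq he hc v]
  simp [sum_inner, inner_smul_left]

theorem bilin_eq_sum [FiniteDimensional ℝ V] {e : ι → V} (he : Orthonormal ℝ e)
    (hc : Fintype.card ι = Module.finrank ℝ V) (B : V →ₗ[ℝ] V →ₗ[ℝ] ℝ) (v w : V) :
    B v w = ∑ i, ∑ j, inner ℝ v (e i) * inner ℝ w (e j) * B (e i) (e j) := by
  conv_lhs => rw [← sum_inner_smul_eq he hc v, ← sum_inner_smul_eq he hc w]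
  simp only [map_sum, map_smul, LinearMap.sum_apply, LinearMap.smul_apply, smul_eq_mul,
    Finset.mul_sum, mul_assoc]
  rw [Finset.sum_comm]
  exact Finset.sum_congr rfl fun i _ ↦ Finset.sum_congr rfl fun j _ ↦ mul_left_comm _ _ _

/-- The metric trace of a bilinear form does not depend on the orthonormal basis. -/
theorem sum_bilin_orthonormal [FiniteDimensional ℝ V] {κ : Type*} [Fintype κ] {e : ι → V}
    {b : κ → V} (he : Orthonormal ℝ e) (hc : Fintype.card ι = Module.finrank ℝ V)
    (hb : Orthonormal ℝ b) (hc' : Fintype.card κ = Module.finrank ℝ V)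
    (B : V →ₗ[ℝ] V →ₗ[ℝ] ℝ) : ∑ k, B (b k) (b k) = ∑ i, B (e i) (e i) := by
  classical
  have h : ∀ k, B (b k) (b k) =
      ∑ i, ∑ j, inner ℝ (b k) (e i) * inner ℝ (b k) (e j) * B (e i) (e j) :=
    fun k ↦ bilin_eq_sum he hc B (b k) (b k)
  simp only [h]
  rw [Finset.sum_comm]
  refine Finset.sum_congr rfl fun i _ ↦ ?_
  rw [Finset.sum_comm]
  simp only [← Finset.sum_mul]
  have h2 : ∀ j, ∑ k, inner ℝ (b k) (e i) * inner ℝ (b k) (e j) = if i = j then 1 else 0 := by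
    intro j
    rw [← orthonormal_iff_ite.1 he i j, ← sum_inner_mul_inner_eq hb hc' (e i) (e j)]
    simp only [real_inner_comm]
  simp [h2]

/-- A bilinear form is trace-invariant under infinitesimal rotations. -/
theorem sum_bilin_skew [FiniteDimensional ℝ V] {e w : ι → V} (he : Orthonormal ℝ e)
    (hc : Fintype.card ι = Module.finrank ℝ V)
    (hw : ∀ i j, inner ℝ (w i) (e j) + inner ℝ (e i) (w j) = 0) (B : V →ₗ[ℝ] V →ₗ[ℝ] ℝ) :
    ∑ i, (B (w i) (e i) + B (e i) (w i)) = 0 := by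
  have h1 : ∀ i, B (w i) (e i) = ∑ j, inner ℝ (w i) (e j) * B (e j) (e i) := fun i ↦ by
    conv_lhs => rw [← sum_inner_smul_eq he hc (w i)]
    simp
  have h2 : ∀ i, B (e i) (w i) = ∑ j, inner ℝ (w i) (e j) * B (e i) (e j) := fun i ↦ by
    conv_lhs => rw [← sum_inner_smul_eq he hc (w i)]
    simp
  rw [Finset.sum_add_distrib]
  simp only [h1, h2]
  rw [Finset.sum_comm, ← Finset.sum_add_distrib]
  refine Finset.sum_eq_zero fun i _ ↦ ?_
  rw [← Finset.sum_add_distrib]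
  refine Finset.sum_eq_zero fun j _ ↦ ?_
  have := hw i j
  rw [real_inner_comm (w j) (e i)] at this
  rw [← add_mul, add_comm, this, zero_mul]

/-- Each basis vector is null for the form, and a null vector of a nonnegative symmetric form lies
in its kernel: `t ↦ B(w + t eᵢ, w + t eᵢ)` is affine and nonnegative, so its slope is zero. -/
theorem bilin_eq_zero_of_trace_eq_zero [FiniteDimensional ℝ V] {e : ι → V} (he : Orthonormal ℝ e)
    (hc : Fintype.card ι = Module.finrank ℝ V) (B : V →ₗ[ℝ] V →ₗ[ℝ] ℝ)
    (hsymm : ∀ v w, B v w = B w v) (hpos : ∀ v, 0 ≤ B v v) (htr : ∑ i, B (e i) (e i) = 0)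
    (v w : V) : B v w = 0 := by
  have h0 : ∀ i, B (e i) (e i) = 0 := fun i ↦
    (Finset.sum_eq_zero_iff_of_nonneg fun j _ ↦ hpos (e j)).1 htr i (Finset.mem_univ i)
  have h1 : ∀ i w, B (e i) w = 0 := by
    intro i w
    have hq : ∀ t : ℝ, 0 ≤ B w w + 2 * t * B (e i) w := by
      intro t
      have h := hpos (w + t • e i)
      simp only [map_add, map_smul, LinearMap.add_apply, LinearMap.smul_apply, smul_eq_mul, h0 i,
        hsymm w (e i)] at h
      linarith
    by_contra hne
    -- This `t` makes the affine function equal to `-1`.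
    have h := hq (-(B w w + 1) / (2 * B (e i) w))
    have h2 : 2 * (-(B w w + 1) / (2 * B (e i) w)) * B (e i) w = -(B w w + 1) := by
      field_simp
    linarith
  rw [← sum_inner_smul_eq he hc v]
  simp [h1]

end LinearAlgebra

/-- If `a > 0`, the second derivative test makes `t` a local minimum as well, so `g` is locally
constant and its second derivative is zero. -/
theorem nonpos_of_isLocalMax_of_hasDerivAt {g g' : ℝ → ℝ} {a t : ℝ}
    (hg : ∀ᶠ s in 𝓝 t, HasDerivAt g (g' s) s) (hg' : HasDerivAt g' a t) (hmax : IsLocalMax g t) :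
    a ≤ 0 := by
  by_contra! ha
  have h1 : deriv g =ᶠ[𝓝 t] g' := hg.mono fun s hs ↦ hs.deriv
  have h2 : deriv (deriv g) t = a := by rw [h1.deriv_eq, hg'.deriv]
  have hmin : IsLocalMin g t := isLocalMin_of_deriv_deriv_pos (h2.symm ▸ ha) hmax.deriv_eq_zero
    hg.self_of_nhds.continuousAt
  have hconst : g =ᶠ[𝓝 t] fun _ ↦ g t := by
    filter_upwards [hmax, hmin] with s h h' using le_antisymm h h'
  have h3 : deriv g =ᶠ[𝓝 t] fun _ ↦ 0 := by
    filter_upwards [hconst.eventuallyEq_nhds] with s hs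
    rw [hs.deriv_eq, deriv_const]
  rw [h3.deriv_eq, deriv_const] at h2
  exact ha.ne h2

section

variable {E : Type*} [NormedAddCommGroup E] [NormedSpace ℝ E] [FiniteDimensional ℝ E]
  {H : Type*} [TopologicalSpace H] {I : ModelWithCorners ℝ E H}
  {M : Type*} [TopologicalSpace M] [ChartedSpace H M] [IsManifold I ∞ M]
  [RiemannianBundle (fun x : M ↦ TangentSpace I x)]
  [IsContMDiffRiemannianBundle I ∞ E (fun x : M ↦ TangentSpace I x)]

set_option linter.unusedSectionVars false

/-! ### Smooth fields, cutoffs and orthonormal frames. -/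

theorem isManifold_infty_add_one : IsManifold I (((⊤ : ℕ∞) : WithTop ℕ∞) + 1) M :=
  inferInstanceAs (IsManifold I ∞ M)

theorem isManifold_minSmoothness_two : IsManifold I (minSmoothness ℝ 2) M := by
  simp only [minSmoothness_of_isRCLikeNormedField]; infer_instance

theorem isManifold_minSmoothness_three : IsManifold I (minSmoothness ℝ 3) M := by
  simp only [minSmoothness_of_isRCLikeNormedField]; infer_instance

attribute [local instance] isManifold_infty_add_one isManifold_minSmoothness_two
  isManifold_minSmoothness_three

theorem contMDiff_dir {f : M → ℝ} {X : Π x : M, TangentSpace I x}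
    (hf : CMDiff ∞ f) (hX : CMDiff ∞ (T% X)) : CMDiff ∞ (fun y : M ↦ d% f y (X y)) := by
  have h1 : CMDiff ∞ (tangentMap% f) := hf.contMDiff_tangentMap le_rfl
  have h2 := h1.comp hX
  exact (contMDiff_snd_tangentBundle_modelSpace ℝ 𝓘(ℝ, ℝ)).comp h2

theorem contMDiff_inner {X Y : Π x : M, TangentSpace I x}
    (hX : CMDiff ∞ (T% X)) (hY : CMDiff ∞ (T% Y)) : CMDiff ∞ (fun y : M ↦ inner ℝ (X y) (Y y)) :=
  ContMDiff.inner_bundle (IB := I) (F := E) (E := fun x : M ↦ TangentSpace I x) hX hY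

theorem contMDiff_mlieBracket {X Y : Π x : M, TangentSpace I x}
    (hX : CMDiff ∞ (T% X)) (hY : CMDiff ∞ (T% Y)) : CMDiff ∞ (T% (mlieBracket I X Y)) :=
  ContDiff.mlieBracket_vectorField (n := ⊤) (m := ⊤) hX hY (by simp)

theorem mdiffAt_of_contMDiff {X : Π x : M, TangentSpace I x} (hX : CMDiff ∞ (T% X)) (x : M) :
    MDiffAt (T% X) x := hX.mdifferentiable (by simp) x

theorem contMDiff_koszul {X Y Z : Π x : M, TangentSpace I x}
    (hX : CMDiff ∞ (T% X)) (hY : CMDiff ∞ (T% Y)) (hZ : CMDiff ∞ (T% Z)) :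
    CMDiff ∞ (koszul (I := I) Y X Z) := by
  have h1 := contMDiff_dir (contMDiff_inner hY hZ) hX
  have h2 := contMDiff_dir (contMDiff_inner hX hZ) hY
  have h3 := contMDiff_dir (contMDiff_inner hX hY) hZ
  have h4 := contMDiff_inner (contMDiff_mlieBracket hX hY) hZ
  have h5 := contMDiff_inner (contMDiff_mlieBracket hX hZ) hY
  have h6 := contMDiff_inner (contMDiff_mlieBracket hY hZ) hX
  exact contMDiff_const.mul (((((h1.add h2).sub h3).add h4).sub h5).sub h6)

/-- A bump function supported in `u` globalizes the field, so that the later calculus can be done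
with globally smooth fields only. -/
theorem exists_contMDiff_eventuallyEq [T2Space M] {X : Π x : M, TangentSpace I x} {x : M}
    {u : Set M} (hu : IsOpen u) (hx : x ∈ u) (hX : CMDiff[u] ∞ (T% X)) :
    ∃ Y : Π x : M, TangentSpace I x, CMDiff ∞ (T% Y) ∧ ∀ᶠ y in 𝓝 x, Y y = X y := by
  obtain ⟨ψ, -, hψ⟩ := (SmoothBumpFunction.nhds_basis_tsupport (I := I) x).mem_iff.1
    (hu.mem_nhds hx)
  refine ⟨(ψ : M → ℝ) • X, ContMDiffOn.smul_section_of_tsupport ψ.contMDiff.contMDiffOn hu hψ hX, ?_⟩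
  filter_upwards [ψ.eventuallyEq_one] with y hy
  simp [hy]

theorem exists_contMDiff_eq [T2Space M] {x : M} (v : TangentSpace I x) :
    ∃ Y : Π x : M, TangentSpace I x, CMDiff ∞ (T% Y) ∧
      (∀ᶠ y in 𝓝 x, Y y = FiberBundle.extend E v y) ∧ Y x = v := by
  obtain ⟨s, hs, h⟩ := FiberBundle.exists_contMDiffOn_extend (k := ∞) I E v
  obtain ⟨u, hus, hu, hxu⟩ := mem_nhds_iff.1 hs
  obtain ⟨Y, hY, hYe⟩ := exists_contMDiff_eventuallyEq hu hxu (h.mono hus)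
  exact ⟨Y, hY, hYe, by simpa using hYe.self_of_nhds⟩

open InnerProductSpace in
-- The recursion divides only by squared norms of earlier vectors, which are nonzero by linear
-- independence.
theorem contMDiffOn_gramSchmidt {ι : Type*} [LinearOrder ι] [LocallyFiniteOrderBot ι]
    [WellFoundedLT ι] {s : ι → Π x : M, TangentSpace I x} {u : Set M}
    (hs : ∀ i, CMDiff[u] ∞ (T% (s i))) (hli : ∀ y ∈ u, LinearIndependent ℝ (fun i ↦ s i y)) (i : ι) :
    CMDiff[u] ∞ (T% (fun y : M ↦ gramSchmidt ℝ (fun j ↦ s j y) i)) := by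
  induction i using WellFoundedLT.induction with
  | ind i ih =>
    have h : ∀ y : M, gramSchmidt ℝ (fun j ↦ s j y) i = s i y - ∑ j ∈ Finset.Iio i,
        (inner ℝ (gramSchmidt ℝ (fun k ↦ s k y) j) (s i y) /
          inner ℝ (gramSchmidt ℝ (fun k ↦ s k y) j) (gramSchmidt ℝ (fun k ↦ s k y) j)) •
            gramSchmidt ℝ (fun k ↦ s k y) j := fun y ↦ by
      rw [eq_sub_iff_add_eq]
      simpa [real_inner_self_eq_norm_sq] using (gramSchmidt_def'' ℝ (fun j ↦ s j y) i).symm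
    simp only [h]
    refine (hs i).sub_section (ContMDiffOn.sum_section fun j hj ↦ ?_)
    have hj' := ih j (Finset.mem_Iio.1 hj)
    refine ContMDiffOn.smul_section (ContMDiffOn.div₀ ?_ ?_ ?_) hj'
    · exact ContMDiffOn.inner_bundle (E := fun x : M ↦ TangentSpace I x) hj' (hs i)
    · exact ContMDiffOn.inner_bundle (E := fun x : M ↦ TangentSpace I x) hj' hj'
    · exact fun y hy ↦ inner_self_ne_zero.2 (gramSchmidt_ne_zero _ (hli y hy))

open InnerProductSpace in
-- Normalized Gram–Schmidt on a local frame, then a cutoff. Orthonormality survives only near `x`,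
-- which suffices for pointwise identities and their derivatives.
theorem exists_orthonormal_frame [T2Space M] (x : M) :
    ∃ e : Fin (Module.finrank ℝ E) → Π x : M, TangentSpace I x,
      (∀ i, CMDiff ∞ (T% (e i))) ∧ ∀ᶠ y in 𝓝 x, Orthonormal ℝ (fun i ↦ e i y) := by
  let t := trivializationAt E (TangentSpace I : M → Type _) x
  have hx : x ∈ t.baseSet := FiberBundle.mem_baseSet_trivializationAt' x
  let s := t.localFrame (Module.finBasis ℝ E)
  have hs : IsLocalFrameOn I E ∞ s t.baseSet :=
    t.isLocalFrameOn_localFrame_baseSet I ∞ (Module.finBasis ℝ E)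
  have hg : ∀ i, CMDiff[t.baseSet] ∞ (T% (fun y : M ↦ gramSchmidtNormed ℝ (fun j ↦ s j y) i)) := by
    intro i
    have h := contMDiffOn_gramSchmidt hs.contMDiffOn (fun y hy ↦ hs.linearIndependent hy) i
    have h0 : ∀ y ∈ t.baseSet, gramSchmidt ℝ (fun j ↦ s j y) i ≠ 0 := fun y hy ↦
      gramSchmidt_ne_zero _ (hs.linearIndependent hy)
    have hn : CMDiff[t.baseSet] ∞ (fun y : M ↦ (‖gramSchmidt ℝ (fun j ↦ s j y) i‖ : ℝ)⁻¹) := by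
      refine ContMDiffOn.inv₀ ?_ fun y hy ↦ norm_ne_zero_iff.2 (h0 y hy)
      have h2 := ContMDiffOn.inner_bundle (E := fun x : M ↦ TangentSpace I x) h h
      simp only [norm_eq_sqrt_real_inner]
      intro y hy
      have hne : inner ℝ (gramSchmidt ℝ (fun j ↦ s j y) i) (gramSchmidt ℝ (fun j ↦ s j y) i) ≠ 0 :=
        inner_self_ne_zero.2 (h0 y hy)
      exact ContMDiffAt.comp_contMDiffWithinAt y
        (Real.contDiffAt_sqrt hne).contMDiffAt (h2 y hy)
    exact hn.smul_section h
  choose e he hee using fun i ↦ exists_contMDiff_eventuallyEq t.open_baseSet hx (hg i)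
  refine ⟨e, he, ?_⟩
  filter_upwards [t.open_baseSet.mem_nhds hx, eventually_all.2 hee] with y hy hye
  simp only [hye]
  exact gramSchmidtNormed_orthonormal (hs.linearIndependent hy)

theorem card_fin_finrank (x : M) :
    Fintype.card (Fin (Module.finrank ℝ E)) = Module.finrank ℝ (TangentSpace I x) := by
  rw [Fintype.card_fin]; rfl

variable {f g : M → ℝ} {X X' Y Y' Z W : Π x : M, TangentSpace I x} {x : M}

/-- Expand `X` in an orthonormal frame. This yields smoothness of fields defined by duality, such as
`∇_X Y` through the Koszul formula and the gradient. -/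
theorem contMDiff_of_inner [T2Space M]
    (h : ∀ Z : Π x : M, TangentSpace I x, CMDiff ∞ (T% Z) → CMDiff ∞ (fun y : M ↦ inner ℝ (X y) (Z y))) :
    CMDiff ∞ (T% X) := by
  intro x
  obtain ⟨e, he, heo⟩ := exists_orthonormal_frame (I := I) x
  have h1 : CMDiffAt ∞ (T% (fun y : M ↦ ∑ i, (inner ℝ (X y) (e i y) : ℝ) • e i y)) x :=
    ContMDiffAt.sum_section fun i _ ↦ ContMDiffAt.smul_section (h _ (he i) x) (he i x)
  refine h1.congr_of_eventuallyEq ?_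
  filter_upwards [heo] with y hy
  rw [sum_inner_smul_eq hy (card_fin_finrank y)]

/-! ### Calculus of directional and covariant derivatives. -/

/-- The derivative `X f` of a function along a vector field. -/
def dir (X : Π x : M, TangentSpace I x) (f : M → ℝ) (x : M) : ℝ := d% f x (X x)

/-- The covariant derivative `∇_X Y` for the Levi-Civita connection. -/
def cov (X Y : Π x : M, TangentSpace I x) (x : M) : TangentSpace I x := leviCivita I M Y x (X x)

theorem ContMDiff.dir (hX : CMDiff ∞ (T% X)) (hf : CMDiff ∞ f) : CMDiff ∞ (dir X f) :=
  contMDiff_dir hf hX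

theorem mdiffAt_fun (hf : CMDiff ∞ f) (x : M) : MDiffAt f x := hf.mdifferentiable (by simp) x

theorem dir_add (hf : CMDiff ∞ f) (hg : CMDiff ∞ g) (x : M) :
    dir X (fun y ↦ f y + g y) x = dir X f x + dir X g x := by
  simp [dir, mvfderiv_fun_add (mdiffAt_fun hf x) (mdiffAt_fun hg x)]

theorem dir_sub (hf : CMDiff ∞ f) (hg : CMDiff ∞ g) (x : M) :
    dir X (fun y ↦ f y - g y) x = dir X f x - dir X g x := by
  simp [dir, mvfderiv_fun_sub (mdiffAt_fun hf x) (mdiffAt_fun hg x)]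

theorem dir_mul (hf : CMDiff ∞ f) (hg : CMDiff ∞ g) (x : M) :
    dir X (fun y ↦ f y * g y) x = f x * dir X g x + g x * dir X f x := by
  simp [dir, mvfderiv_fun_mul (mdiffAt_fun hf x) (mdiffAt_fun hg x)]

theorem dir_const (c : ℝ) (x : M) : dir X (fun _ ↦ c) x = 0 := by
  simp [dir, mvfderiv_const]

theorem dir_congr (h : ∀ᶠ y in 𝓝 x, f y = g y) : dir X f x = dir X g x := by
  have : d% f x = d% g x := by
    simp only [mvfderiv]
    rw [Filter.EventuallyEq.mfderiv_eq h, h.self_of_nhds]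
  simp [dir, this]

theorem inner_cov (hX : CMDiff ∞ (T% X)) (hY : CMDiff ∞ (T% Y)) (hZ : CMDiff ∞ (T% Z)) (x : M) :
    inner ℝ (cov X Y x) (Z x) = koszul (I := I) Y X Z x :=
  inner_leviCivitaFun (mdiffAt_of_contMDiff hY x) (mdiffAt_of_contMDiff hX x)
    (mdiffAt_of_contMDiff hZ x)

theorem contMDiff_cov [T2Space M] (hX : CMDiff ∞ (T% X)) (hY : CMDiff ∞ (T% Y)) :
    CMDiff ∞ (T% (cov X Y)) :=
  contMDiff_of_inner fun Z hZ ↦ by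
    simp only [inner_cov hX hY hZ]
    exact contMDiff_koszul hX hY hZ

theorem cov_add (hY : CMDiff ∞ (T% Y)) (hY' : CMDiff ∞ (T% Y')) (x : M) :
    cov X (Y + Y') x = cov X Y x + cov X Y' x := by
  have := (leviCivita I M).isCovariantDerivativeOnUniv.add (mdiffAt_of_contMDiff hY x)
    (mdiffAt_of_contMDiff hY' x)
  exact DFunLike.congr_fun this (X x)

theorem cov_smul (hf : CMDiff ∞ f) (hY : CMDiff ∞ (T% Y)) (x : M) :
    cov X (f • Y) x = f x • cov X Y x + dir X f x • Y x := by
  have := (leviCivita I M).isCovariantDerivativeOnUniv.leibniz (mdiffAt_of_contMDiff hY x)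
    (mdiffAt_fun hf x)
  exact DFunLike.congr_fun this (X x)

theorem cov_neg (hY : CMDiff ∞ (T% Y)) (x : M) : cov X (-Y) x = - cov X Y x := by
  have h := cov_smul (X := X) (f := fun _ ↦ (-1 : ℝ)) contMDiff_const hY x
  rw [dir_const, zero_smul, add_zero, neg_one_smul] at h
  rw [← h]
  congr 1
  ext y
  simp

theorem cov_sub (hY : CMDiff ∞ (T% Y)) (hY' : CMDiff ∞ (T% Y')) (x : M) :
    cov X (Y - Y') x = cov X Y x - cov X Y' x := by
  rw [sub_eq_add_neg, cov_add hY hY'.neg_section, cov_neg hY', sub_eq_add_neg]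

theorem cov_congr (hY : MDiffAt (T% Y) x) (hY' : MDiffAt (T% Y') x)
    (h : ∀ᶠ y in 𝓝 x, Y y = Y' y) (hX : X x = X' x) : cov X Y x = cov X' Y' x := by
  have := (leviCivita I M).isCovariantDerivativeOnUniv.congr_of_eventuallyEq hY hY'
    Filter.univ_mem h
  rw [cov, cov, hX]
  exact DFunLike.congr_fun this (X' x)

theorem cov_sub_cov (hX : CMDiff ∞ (T% X)) (hY : CMDiff ∞ (T% Y)) (x : M) :
    cov X Y x - cov Y X x = mlieBracket I X Y x :=
  ((CovariantDerivative.torsion_eq_zero_iff _).1 (leviCivita_torsion (I := I) (M := M)))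
    (mdiffAt_of_contMDiff hX x) (mdiffAt_of_contMDiff hY x)

theorem dir_inner (hX : CMDiff ∞ (T% X)) (hY : CMDiff ∞ (T% Y)) (hZ : CMDiff ∞ (T% Z)) (x : M) :
    dir X (fun y : M ↦ inner ℝ (Y y) (Z y)) x =
      inner ℝ (cov X Y x) (Z x) + inner ℝ (Y x) (cov X Z x) :=
  leviCivita_metric (mdiffAt_of_contMDiff hX x) (mdiffAt_of_contMDiff hY x)
    (mdiffAt_of_contMDiff hZ x)

theorem mlieBracket_jacobi (hX : CMDiff ∞ (T% X)) (hY : CMDiff ∞ (T% Y)) (hZ : CMDiff ∞ (T% Z)) (x : M) :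
    mlieBracket I X (mlieBracket I Y Z) x =
      mlieBracket I (mlieBracket I X Y) Z x + mlieBracket I Y (mlieBracket I X Z) x := by
  have h2 : minSmoothness ℝ 2 ≤ ∞ := by
    simp only [minSmoothness_of_isRCLikeNormedField]; exact ENat.LEInfty.out
  exact leibniz_identity_mlieBracket_apply ((hX x).of_le h2) ((hY x).of_le h2) ((hZ x).of_le h2)

/-- The Lie bracket is the commutator of directional derivatives. -/
theorem dir_mlieBracket [T2Space M] (hX : CMDiff ∞ (T% X)) (hY : CMDiff ∞ (T% Y)) (hf : CMDiff ∞ f)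
    (x : M) : dir (mlieBracket I X Y) f x = dir X (dir Y f) x - dir Y (dir X f) x := by
  -- In dimension zero there is no nonzero vector to test with, but all derivatives vanish.
  rcases subsingleton_or_nontrivial (TangentSpace I x) with hs | hs
  · simp [dir, Subsingleton.elim (X x) 0, Subsingleton.elim (Y x) 0,
      Subsingleton.elim (mlieBracket I X Y x) 0]
  obtain ⟨v, hv⟩ := exists_ne (0 : TangentSpace I x)
  obtain ⟨Z, hZ, -, hZx⟩ := exists_contMDiff_eq (I := I) v
  have key : ∀ {A B : Π x : M, TangentSpace I x} {g : M → ℝ}, CMDiff ∞ (T% A) → CMDiff ∞ (T% B) →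
      CMDiff ∞ g → mlieBracket I A (g • B) = dir A g • B + g • mlieBracket I A B := by
    intro A B g hA hB hg
    ext y
    exact mlieBracket_smul_right (mdiffAt_fun hg y) (mdiffAt_of_contMDiff hB y)
  -- The Jacobi identity for `X`, `Y`, `f Z`, minus `f` times the one for `X`, `Y`, `Z`, leaves `(X
  -- Y f - Y X f - [X,Y] f) Z = 0`.
  have hfZ : CMDiff ∞ (T% (f • Z)) := hf.smul_section hZ
  have h := mlieBracket_jacobi hX hY hfZ x
  have h' := mlieBracket_jacobi hX hY hZ x
  have hadd : ∀ {A B C : Π x : M, TangentSpace I x}, CMDiff ∞ (T% B) → CMDiff ∞ (T% C) →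
      mlieBracket I A (B + C) x = mlieBracket I A B x + mlieBracket I A C x := fun hB hC ↦
    mlieBracket_add_right (mdiffAt_of_contMDiff hB x) (mdiffAt_of_contMDiff hC x)
  have hYf := ContMDiff.dir hY hf
  have hXf := ContMDiff.dir hX hf
  have bYZ := contMDiff_mlieBracket hY hZ
  have bXZ := contMDiff_mlieBracket hX hZ
  have bXY := contMDiff_mlieBracket hX hY
  rw [key hY hZ hf, key hX hZ hf, key bXY hZ hf, hadd (hYf.smul_section hZ) (hf.smul_section bYZ),
    hadd (hXf.smul_section hZ) (hf.smul_section bXZ), key hX hZ hYf, key hX bYZ hf,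
    key hY hZ hXf, key hY bXZ hf] at h
  simp only [Pi.add_apply, Pi.smul_apply', h', smul_add, hZx] at h
  have h3 : (dir X (dir Y f) x - dir Y (dir X f) x - dir (mlieBracket I X Y) f x) • v = 0 := by
    rw [← sub_eq_zero] at h
    rw [← h]
    module
  have := (smul_eq_zero.1 h3).resolve_right hv
  linarith

variable [T2Space M] {u v ρ : M → ℝ} {Z' V : Π x : M, TangentSpace I x}

/-! ### Symmetries and tensoriality of the curvature, and the Bianchi identities. -/

theorem curvature_eq (X Y Z : Π x : M, TangentSpace I x) :
    curvature (I := I) X Y Z =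
      cov X (cov Y Z) - cov Y (cov X Z) - cov (mlieBracket I X Y) Z := rfl

theorem contMDiff_curvature (hX : CMDiff ∞ (T% X)) (hY : CMDiff ∞ (T% Y)) (hZ : CMDiff ∞ (T% Z)) :
    CMDiff ∞ (T% (curvature (I := I) X Y Z)) := by
  rw [curvature_eq]
  exact ((contMDiff_cov hX (contMDiff_cov hY hZ)).sub_section
    (contMDiff_cov hY (contMDiff_cov hX hZ))).sub_section
      (contMDiff_cov (contMDiff_mlieBracket hX hY) hZ)

theorem curvature_swap (X Y Z : Π x : M, TangentSpace I x) (x : M) :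
    curvature (I := I) X Y Z x = - curvature (I := I) Y X Z x := by
  have h : cov (mlieBracket I X Y) Z x = - cov (mlieBracket I Y X) Z x := by
    simp only [cov]
    rw [mlieBracket_swap_apply, map_neg]
  simp only [curvature_eq, Pi.sub_apply, h]
  abel

/-- Apply `[X,Y] = XY - YX` to the function `g(Z,W)` and expand by metric compatibility; the mixed
first-order terms cancel. -/
theorem inner_curvature_swap (hX : CMDiff ∞ (T% X)) (hY : CMDiff ∞ (T% Y)) (hZ : CMDiff ∞ (T% Z))
    (hW : CMDiff ∞ (T% W)) (x : M) :
    inner ℝ (curvature (I := I) X Y Z x) (W x) = - inner ℝ (curvature (I := I) X Y W x) (Z x) := by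
  have second : ∀ {A B : Π x : M, TangentSpace I x}, CMDiff ∞ (T% A) → CMDiff ∞ (T% B) →
      dir A (dir B (fun y : M ↦ inner ℝ (Z y) (W y))) x =
        inner ℝ (cov A (cov B Z) x) (W x) + inner ℝ (cov B Z x) (cov A W x) +
          (inner ℝ (cov A Z x) (cov B W x) + inner ℝ (Z x) (cov A (cov B W) x)) := by
    intro A B hA hB
    have h1 : dir B (fun y : M ↦ inner ℝ (Z y) (W y)) =
        fun y : M ↦ inner ℝ (cov B Z y) (W y) + inner ℝ (Z y) (cov B W y) :=
      funext fun y ↦ dir_inner hB hZ hW y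
    rw [h1, dir_add (contMDiff_inner (contMDiff_cov hB hZ) hW)
      (contMDiff_inner hZ (contMDiff_cov hB hW)), dir_inner hA (contMDiff_cov hB hZ) hW,
      dir_inner hA hZ (contMDiff_cov hB hW)]
  have h := dir_mlieBracket hX hY (contMDiff_inner hZ hW) x
  rw [second hX hY, second hY hX, dir_inner (contMDiff_mlieBracket hX hY) hZ hW] at h
  simp only [curvature_eq, Pi.sub_apply, inner_sub_left]
  simp only [real_inner_comm (Z x)] at h ⊢
  linarith

theorem cov_add_left (x : M) : cov (X + X') Y x = cov X Y x + cov X' Y x := by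
  simp [cov]

theorem cov_apply_congr (h : X x = X' x) : cov X Y x = cov X' Y x := by
  simp [cov, h]

/-- The first Bianchi identity. -/
theorem curvature_bianchi_first (hX : CMDiff ∞ (T% X)) (hY : CMDiff ∞ (T% Y))
    (hZ : CMDiff ∞ (T% Z)) (x : M) :
    curvature (I := I) X Y Z x + curvature (I := I) Y Z X x + curvature (I := I) Z X Y x = 0 := by
  -- Vanishing torsion turns the cyclic sum into double brackets, which the Jacobi identity cancels.
  have key : ∀ {A B C : Π x : M, TangentSpace I x}, CMDiff ∞ (T% A) → CMDiff ∞ (T% B) →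
      CMDiff ∞ (T% C) → cov A (cov B C) x - cov A (cov C B) x - cov (mlieBracket I B C) A x =
        mlieBracket I A (mlieBracket I B C) x := by
    intro A B C hA hB hC
    have h : mlieBracket I B C = cov B C - cov C B := funext fun y ↦ (cov_sub_cov hB hC y).symm
    rw [← cov_sub_cov hA (contMDiff_mlieBracket hB hC) x, ← cov_sub (contMDiff_cov hB hC)
      (contMDiff_cov hC hB), ← h]
  have h1 := key hX hY hZ
  have h2 := key hY hZ hX
  have h3 := key hZ hX hY
  have hJ := mlieBracket_jacobi hX hY hZ x
  rw [mlieBracket_swap_apply (V := mlieBracket I X Y), mlieBracket_swap (V := X) (W := Z)] at hJ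
  have hneg : mlieBracket I Y (-mlieBracket I Z X) x = - mlieBracket I Y (mlieBracket I Z X) x := by
    have := mlieBracket_const_smul_right (I := I) (V := Y) (c := (-1 : ℝ))
      (mdiffAt_of_contMDiff (contMDiff_mlieBracket hZ hX) x)
    simpa using this
  rw [hneg, ← h1, ← h2, ← h3] at hJ
  simp only [curvature_eq, Pi.sub_apply]
  rw [← sub_eq_zero] at hJ
  rw [← hJ]
  abel

/-- The pair symmetry of the curvature tensor. -/
theorem inner_curvature_pair (hX : CMDiff ∞ (T% X)) (hY : CMDiff ∞ (T% Y)) (hZ : CMDiff ∞ (T% Z))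
    (hW : CMDiff ∞ (T% W)) (x : M) :
    inner ℝ (curvature (I := I) X Y Z x) (W x) = inner ℝ (curvature (I := I) Z W X x) (Y x) := by
  have b : ∀ {A B C D : Π x : M, TangentSpace I x}, CMDiff ∞ (T% A) → CMDiff ∞ (T% B) →
      CMDiff ∞ (T% C) → inner ℝ (curvature (I := I) A B C x) (D x) +
        inner ℝ (curvature (I := I) B C A x) (D x) +
          inner ℝ (curvature (I := I) C A B x) (D x) = 0 := by
    intro A B C D hA hB hC
    rw [← inner_add_left, ← inner_add_left, curvature_bianchi_first hA hB hC, inner_zero_left]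
  have s : ∀ (A B C D : Π x : M, TangentSpace I x), inner ℝ (curvature (I := I) A B C x) (D x) =
      - inner ℝ (curvature (I := I) B A C x) (D x) := by
    intro A B C D
    rw [curvature_swap, inner_neg_left]
  -- The octahedron argument: four first Bianchi identities, combined with skewness in each pair of
  -- slots.
  have b1 := b (D := W) hX hY hZ
  have b2 := b (D := X) hY hZ hW
  have b3 := b (D := Y) hZ hW hX
  have b4 := b (D := Z) hW hX hY
  have t1 := inner_curvature_swap hX hY hZ hW x
  have t2 := inner_curvature_swap hY hZ hX hW x
  have t3 := inner_curvature_swap hZ hX hY hW x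
  have t4 := inner_curvature_swap hZ hW hY hX x
  have t5 := inner_curvature_swap hW hY hZ hX x
  have t6 := inner_curvature_swap hW hX hZ hY x
  have s1 := s X Y W Z
  have s2 := s Y Z W X
  have s3 := s Z X W Y
  have s4 := s X W Y Z
  have s5 := s W Y Z X
  have s6 := s W X Z Y
  have s7 := s W Y X Z
  have s8 := s Z W X Y
  have s9 := s Z W Y X
  linarith

/-- A map on smooth fields that is linear over smooth functions at `x` only depends on the value
of the field at `x`. -/
theorem apply_eq_of_tensorial {A : Type*} [AddCommGroup A] [Module ℝ A]
    (Φ : (Π x : M, TangentSpace I x) → A)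
    (hadd : ∀ X Y : Π x : M, TangentSpace I x, CMDiff ∞ (T% X) → CMDiff ∞ (T% Y) →
      Φ (X + Y) = Φ X + Φ Y)
    (hsmul : ∀ (f : M → ℝ) (X : Π x : M, TangentSpace I x), CMDiff ∞ f → CMDiff ∞ (T% X) →
      Φ (f • X) = f x • Φ X)
    (hX : CMDiff ∞ (T% X)) (hY : CMDiff ∞ (T% Y)) (h : X x = Y x) : Φ X = Φ Y := by
  have hzero : Φ 0 = 0 := by
    have := hsmul (fun _ ↦ 0) X contMDiff_const hX
    rw [zero_smul] at this
    rw [← this]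
    congr 1
    ext y
    simp
  -- Locality: multiplying by a bump function equal to `1` at `x` does not change `Φ`. Hence the
  -- frame expansion, valid only near `x`, determines `Φ`.
  have hloc : ∀ X Y : Π x : M, TangentSpace I x, CMDiff ∞ (T% X) → CMDiff ∞ (T% Y) →
      (∀ᶠ y in 𝓝 x, X y = Y y) → Φ X = Φ Y := by
    intro X Y hX hY h
    obtain ⟨ψ, -, hψ⟩ := (SmoothBumpFunction.nhds_basis_tsupport (I := I) x).mem_iff.1 h
    have h1 := hsmul ψ X ψ.contMDiff hX
    have h2 := hsmul ψ Y ψ.contMDiff hY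
    rw [ψ.eq_one, one_smul] at h1 h2
    rw [← h1, ← h2]
    congr 1
    ext y
    by_cases hy : y ∈ tsupport ψ
    · simp [show X y = Y y from hψ hy]
    · simp [image_eq_zero_of_notMem_tsupport hy]
  obtain ⟨e, he, heo⟩ := exists_orthonormal_frame (I := I) x
  have hsum : ∀ (s : Finset (Fin (Module.finrank ℝ E))) (X : Π x : M, TangentSpace I x),
      CMDiff ∞ (T% X) → Φ (∑ i ∈ s, (fun y : M ↦ (inner ℝ (X y) (e i y) : ℝ)) • e i) =
        ∑ i ∈ s, (inner ℝ (X x) (e i x) : ℝ) • Φ (e i) := by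
    intro s X hX
    have hc : ∀ i, CMDiff ∞ (fun y : M ↦ (inner ℝ (X y) (e i y) : ℝ)) := fun i ↦
      contMDiff_inner hX (he i)
    induction s using Finset.cons_induction with
    | empty => simpa using hzero
    | cons i s hi ih =>
      rw [Finset.sum_cons, Finset.sum_cons, hadd _ _ ((hc i).smul_section (he i)) ?_,
        hsmul _ _ (hc i) (he i), ih]
      have := ContMDiff.sum_section (s := s)
        (t := fun i ↦ (fun y : M ↦ (inner ℝ (X y) (e i y) : ℝ)) • e i)
        fun j _ ↦ (hc j).smul_section (he j)
      convert this using 3 with y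
      simp
  have hexp : ∀ X : Π x : M, TangentSpace I x, CMDiff ∞ (T% X) →
      Φ X = ∑ i, (inner ℝ (X x) (e i x) : ℝ) • Φ (e i) := by
    intro X hX
    rw [← hsum _ X hX]
    refine hloc _ _ hX ?_ ?_
    · have := ContMDiff.sum_section (s := Finset.univ)
        (t := fun i ↦ (fun y : M ↦ (inner ℝ (X y) (e i y) : ℝ)) • e i)
        fun j _ ↦ (contMDiff_inner hX (he j)).smul_section (he j)
      convert this using 3 with y
      simp
    · filter_upwards [heo] with y hy
      simp [sum_inner_smul_eq hy (card_fin_finrank y)]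
  rw [hexp X hX, hexp Y hY, h]

theorem curvature_add_left (hX : CMDiff ∞ (T% X)) (hX' : CMDiff ∞ (T% X'))
    (hZ : CMDiff ∞ (T% Z)) (x : M) : curvature (I := I) (X + X') Y Z x =
      curvature (I := I) X Y Z x + curvature (I := I) X' Y Z x := by
  have h1 : cov (X + X') Z = cov X Z + cov X' Z := funext fun y ↦ cov_add_left y
  have h2 : cov (mlieBracket I (X + X') Y) Z x =
      cov (mlieBracket I X Y) Z x + cov (mlieBracket I X' Y) Z x := by
    rw [← cov_add_left]
    exact cov_apply_congr
      (mlieBracket_add_left (mdiffAt_of_contMDiff hX x) (mdiffAt_of_contMDiff hX' x))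
  simp only [curvature_eq, Pi.sub_apply, h1, h2, cov_add_left,
    cov_add (contMDiff_cov hX hZ) (contMDiff_cov hX' hZ)]
  abel

theorem curvature_smul_left (hf : CMDiff ∞ f) (hX : CMDiff ∞ (T% X))
    (hZ : CMDiff ∞ (T% Z)) (x : M) :
    curvature (I := I) (f • X) Y Z x = f x • curvature (I := I) X Y Z x := by
  have h0 : ∀ W : Π x : M, TangentSpace I x, cov (f • X) W = f • cov X W := fun W ↦ by
    ext y; simp [cov]
  have h2 : cov (mlieBracket I (f • X) Y) Z x =
      f x • cov (mlieBracket I X Y) Z x - dir Y f x • cov X Z x := by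
    have := mlieBracket_smul_left (I := I) (W := Y) (mdiffAt_fun hf x) (mdiffAt_of_contMDiff hX x)
    simp only [cov, this, dir]
    simp
    abel
  simp only [curvature_eq, Pi.sub_apply, h0, h2, cov_smul hf (contMDiff_cov hX hZ), Pi.smul_apply']
  module

theorem curvature_congr_left (hX : CMDiff ∞ (T% X)) (hX' : CMDiff ∞ (T% X'))
    (hZ : CMDiff ∞ (T% Z)) (h : X x = X' x) :
    curvature (I := I) X Y Z x = curvature (I := I) X' Y Z x :=
  apply_eq_of_tensorial (fun X ↦ curvature (I := I) X Y Z x)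
    (fun _ _ hA hB ↦ curvature_add_left hA hB hZ x)
    (fun _ _ hf hA ↦ curvature_smul_left hf hA hZ x) hX hX' h

/-- Tensoriality in the first slot suffices: skewness carries it to the second slot and pair
symmetry to the third. -/
theorem curvature_congr (hX : CMDiff ∞ (T% X)) (hX' : CMDiff ∞ (T% X')) (hY : CMDiff ∞ (T% Y))
    (hY' : CMDiff ∞ (T% Y')) (hZ : CMDiff ∞ (T% Z)) (hZ' : CMDiff ∞ (T% Z'))
    (h1 : X x = X' x) (h2 : Y x = Y' x) (h3 : Z x = Z' x) :
    curvature (I := I) X Y Z x = curvature (I := I) X' Y' Z' x := by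
  rw [curvature_congr_left hX hX' hZ h1, curvature_swap, curvature_congr_left hY hY' hZ h2,
    ← curvature_swap]
  refine ext_inner_right ℝ fun w ↦ ?_
  obtain ⟨W, hW, -, rfl⟩ := exists_contMDiff_eq (I := I) w
  rw [inner_curvature_pair hX' hY' hZ hW, inner_curvature_pair hX' hY' hZ' hW,
    curvature_congr_left hZ hZ' hX' h3]

theorem mdiffAt_of_eventuallyEq (hY : CMDiff ∞ (T% Y)) (h : ∀ᶠ y in 𝓝 x, Y' y = Y y) :
    MDiffAt (T% Y') x := by
  refine (mdiffAt_of_contMDiff hY x).congr_of_eventuallyEq ?_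
  filter_upwards [h] with y hy
  rw [hy]

theorem cov_eventuallyEq (hY : CMDiff ∞ (T% Y)) (h : ∀ᶠ y in 𝓝 x, Y' y = Y y)
    (hX : ∀ᶠ y in 𝓝 x, X' y = X y) : ∀ᶠ y in 𝓝 x, cov X' Y' y = cov X Y y := by
  filter_upwards [h.eventually_nhds, hX] with y hy hXy
  exact cov_congr (mdiffAt_of_eventuallyEq hY hy) (mdiffAt_of_contMDiff hY y) hy hXy

theorem curvature_eq_of_eventuallyEq (hX : CMDiff ∞ (T% X)) (hY : CMDiff ∞ (T% Y))
    (hZ : CMDiff ∞ (T% Z)) (eX : ∀ᶠ y in 𝓝 x, X' y = X y) (eY : ∀ᶠ y in 𝓝 x, Y' y = Y y)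
    (eZ : ∀ᶠ y in 𝓝 x, Z' y = Z y) :
    curvature (I := I) X' Y' Z' x = curvature (I := I) X Y Z x := by
  have hb : mlieBracket I X' Y' x = mlieBracket I X Y x :=
    Filter.EventuallyEq.mlieBracket_vectorField_eq eX eY
  have h1 := (cov_eventuallyEq (contMDiff_cov hY hZ) (cov_eventuallyEq hZ eZ eY) eX).self_of_nhds
  have h2 := (cov_eventuallyEq (contMDiff_cov hX hZ) (cov_eventuallyEq hZ eZ eX) eY).self_of_nhds
  have h3 : cov (mlieBracket I X' Y') Z' x = cov (mlieBracket I X Y) Z x :=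
    cov_congr (mdiffAt_of_eventuallyEq hZ eZ) (mdiffAt_of_contMDiff hZ x) eZ hb
  simp only [curvature_eq, Pi.sub_apply, h1, h2, h3]

/-- Bridges `curvatureAt`, built on extensions smooth only near `x`, to global smooth fields:
replace the extensions by global fields with the same germs, then use tensoriality. -/
theorem curvatureAt_eq (hX : CMDiff ∞ (T% X)) (hY : CMDiff ∞ (T% Y)) (hZ : CMDiff ∞ (T% Z)) (x : M) :
    curvatureAt x (X x) (Y x) (Z x) = curvature (I := I) X Y Z x := by
  obtain ⟨X', hX', eX, h1⟩ := exists_contMDiff_eq (I := I) (X x)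
  obtain ⟨Y', hY', eY, h2⟩ := exists_contMDiff_eq (I := I) (Y x)
  obtain ⟨Z', hZ', eZ, h3⟩ := exists_contMDiff_eq (I := I) (Z x)
  rw [curvatureAt, curvature_eq_of_eventuallyEq hX' hY' hZ' (eX.mono fun _ h ↦ h.symm)
    (eY.mono fun _ h ↦ h.symm) (eZ.mono fun _ h ↦ h.symm)]
  exact curvature_congr hX' hX hY' hY hZ' hZ h1 h2 h3

/-- The second Bianchi identity. -/
theorem curvature_bianchi_second (hX : CMDiff ∞ (T% X)) (hY : CMDiff ∞ (T% Y))
    (hV : CMDiff ∞ (T% V)) (hZ : CMDiff ∞ (T% Z)) (x : M) :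
    (cov V (curvature (I := I) X Y Z) x - curvature (I := I) X Y (cov V Z) x
        + curvature (I := I) V (mlieBracket I X Y) Z x)
      + (cov X (curvature (I := I) Y V Z) x - curvature (I := I) Y V (cov X Z) x
        + curvature (I := I) X (mlieBracket I Y V) Z x)
      + (cov Y (curvature (I := I) V X Z) x - curvature (I := I) V X (cov Y Z) x
        + curvature (I := I) Y (mlieBracket I V X) Z x) = 0 := by
  have key : ∀ {A B C : Π x : M, TangentSpace I x}, CMDiff ∞ (T% A) → CMDiff ∞ (T% B) →
      CMDiff ∞ (T% C) → cov C (curvature (I := I) A B Z) x =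
        cov C (cov A (cov B Z)) x - cov C (cov B (cov A Z)) x - cov C (cov (mlieBracket I A B) Z) x := by
    intro A B C hA hB hC
    have h1 := contMDiff_cov hA (contMDiff_cov hB hZ)
    have h2 := contMDiff_cov hB (contMDiff_cov hA hZ)
    rw [curvature_eq, cov_sub (h1.sub_section h2) (contMDiff_cov (contMDiff_mlieBracket hA hB) hZ),
      cov_sub h1 h2]
  have hJ : cov (mlieBracket I V (mlieBracket I X Y)) Z x +
      cov (mlieBracket I X (mlieBracket I Y V)) Z x +
      cov (mlieBracket I Y (mlieBracket I V X)) Z x = 0 := by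
    have hJ := mlieBracket_jacobi hX hY hV x
    rw [mlieBracket_swap_apply (V := mlieBracket I X Y), mlieBracket_swap (V := X) (W := V)] at hJ
    have hneg : mlieBracket I Y (-mlieBracket I V X) x = - mlieBracket I Y (mlieBracket I V X) x := by
      have := mlieBracket_const_smul_right (I := I) (V := Y) (c := (-1 : ℝ))
        (mdiffAt_of_contMDiff (contMDiff_mlieBracket hV hX) x)
      simpa using this
    simp only [cov, hJ, hneg, map_add, map_neg]
    abel
  -- In the cyclic sum all iterated derivatives of `Z` cancel, except the derivative along the
  -- Jacobi sum of double brackets.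
  rw [key hX hY hV, key hY hV hX, key hV hX hY]
  simp only [curvature_eq, Pi.sub_apply]
  rw [← neg_eq_zero, ← hJ]
  abel

/-! ### The pointwise curvature tensor and its Ricci trace. -/

theorem curvatureAt_add_left (u u' v w : TangentSpace I x) :
    curvatureAt x (u + u') v w = curvatureAt x u v w + curvatureAt x u' v w := by
  obtain ⟨U, hU, -, rfl⟩ := exists_contMDiff_eq (I := I) u
  obtain ⟨U', hU', -, rfl⟩ := exists_contMDiff_eq (I := I) u'
  obtain ⟨V, hV, -, rfl⟩ := exists_contMDiff_eq (I := I) v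
  obtain ⟨W, hW, -, rfl⟩ := exists_contMDiff_eq (I := I) w
  rw [curvatureAt_eq hU hV hW, curvatureAt_eq hU' hV hW, ← curvature_add_left hU hU' hW,
    ← curvatureAt_eq (hU.add_section hU') hV hW]
  rfl

theorem curvatureAt_smul_left (c : ℝ) (u v w : TangentSpace I x) :
    curvatureAt x (c • u) v w = c • curvatureAt x u v w := by
  obtain ⟨U, hU, -, rfl⟩ := exists_contMDiff_eq (I := I) u
  obtain ⟨V, hV, -, rfl⟩ := exists_contMDiff_eq (I := I) v
  obtain ⟨W, hW, -, rfl⟩ := exists_contMDiff_eq (I := I) w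
  have hc : CMDiff ∞ (fun _ : M ↦ c) := contMDiff_const
  rw [curvatureAt_eq hU hV hW, ← curvature_smul_left hc hU hW,
    ← curvatureAt_eq (hc.smul_section hU) hV hW]
  rfl

theorem curvatureAt_swap (u v w : TangentSpace I x) :
    curvatureAt x u v w = - curvatureAt x v u w :=
  curvature_swap _ _ _ _

theorem inner_curvatureAt_swap (u v w z : TangentSpace I x) :
    inner ℝ (curvatureAt x u v w) z = - inner ℝ (curvatureAt x u v z) w := by
  obtain ⟨U, hU, -, rfl⟩ := exists_contMDiff_eq (I := I) u
  obtain ⟨V, hV, -, rfl⟩ := exists_contMDiff_eq (I := I) v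
  obtain ⟨W, hW, -, rfl⟩ := exists_contMDiff_eq (I := I) w
  obtain ⟨Z, hZ, -, rfl⟩ := exists_contMDiff_eq (I := I) z
  rw [curvatureAt_eq hU hV hW, curvatureAt_eq hU hV hZ, inner_curvature_swap hU hV hW hZ]

theorem inner_curvatureAt_pair (u v w z : TangentSpace I x) :
    inner ℝ (curvatureAt x u v w) z = inner ℝ (curvatureAt x w z u) v := by
  obtain ⟨U, hU, -, rfl⟩ := exists_contMDiff_eq (I := I) u
  obtain ⟨V, hV, -, rfl⟩ := exists_contMDiff_eq (I := I) v
  obtain ⟨W, hW, -, rfl⟩ := exists_contMDiff_eq (I := I) w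
  obtain ⟨Z, hZ, -, rfl⟩ := exists_contMDiff_eq (I := I) z
  rw [curvatureAt_eq hU hV hW, curvatureAt_eq hW hZ hU, inner_curvature_pair hU hV hW hZ]

theorem curvatureAt_add_mid (u v v' w : TangentSpace I x) :
    curvatureAt x u (v + v') w = curvatureAt x u v w + curvatureAt x u v' w := by
  rw [curvatureAt_swap, curvatureAt_add_left, curvatureAt_swap u v, curvatureAt_swap u v']
  abel

theorem curvatureAt_smul_mid (c : ℝ) (u v w : TangentSpace I x) :
    curvatureAt x u (c • v) w = c • curvatureAt x u v w := by
  rw [curvatureAt_swap, curvatureAt_smul_left, curvatureAt_swap u v, smul_neg]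

/-- The metric trace of a bilinear form may be computed in any orthonormal basis. -/
theorem metricTrace_eq_sum {e : Fin (Module.finrank ℝ E) → TangentSpace I x} (he : Orthonormal ℝ e)
    (B : TangentSpace I x →ₗ[ℝ] TangentSpace I x →ₗ[ℝ] ℝ) :
    metricTrace (fun u v ↦ B u v) = ∑ i, B (e i) (e i) :=
  sum_bilin_orthonormal he (card_fin_finrank x)
    (stdOrthonormalBasis ℝ (TangentSpace I x)).orthonormal (by rw [Fintype.card_fin]) B

/-- The bilinear form `(u, z) ↦ g(R(u, v)w, z)`. -/
def curvatureForm (x : M) (v w : TangentSpace I x) :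
    TangentSpace I x →ₗ[ℝ] TangentSpace I x →ₗ[ℝ] ℝ :=
  LinearMap.mk₂ ℝ (fun u z ↦ inner ℝ (curvatureAt x u v w) z)
    (fun u u' z ↦ by rw [curvatureAt_add_left, inner_add_left])
    (fun c u z ↦ by rw [curvatureAt_smul_left, inner_smul_left]; rfl)
    (fun u z z' ↦ inner_add_right _ _ _)
    (fun c u z ↦ inner_smul_right _ _ _)

theorem ricci_eq_sum {e : Fin (Module.finrank ℝ E) → TangentSpace I x} (he : Orthonormal ℝ e)
    (v w : TangentSpace I x) : ricci x v w = ∑ i, inner ℝ (curvatureAt x (e i) v w) (e i) :=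
  metricTrace_eq_sum he (curvatureForm x v w)

theorem ricci_comm (v w : TangentSpace I x) : ricci x v w = ricci x w v := by
  simp only [ricci, metricTrace]
  refine Finset.sum_congr rfl fun i _ ↦ ?_
  rw [inner_curvatureAt_pair, curvatureAt_swap, inner_neg_left, inner_curvatureAt_swap, neg_neg]

theorem ricci_add_left (v v' w : TangentSpace I x) :
    ricci x (v + v') w = ricci x v w + ricci x v' w := by
  simp only [ricci, metricTrace, ← Finset.sum_add_distrib]
  refine Finset.sum_congr rfl fun i _ ↦ ?_
  rw [curvatureAt_add_mid, inner_add_left]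

theorem ricci_smul_left (c : ℝ) (v w : TangentSpace I x) :
    ricci x (c • v) w = c * ricci x v w := by
  simp only [ricci, metricTrace, Finset.mul_sum]
  refine Finset.sum_congr rfl fun i _ ↦ ?_
  rw [curvatureAt_smul_mid, inner_smul_left]; rfl

/-! ### Gradient, Hessian and Laplacian. -/

theorem inner_gradient (f : M → ℝ) (x : M) (v : TangentSpace I x) :
    inner ℝ (gradient I f x) v = d% f x v := by
  simp [gradient]

theorem dir_eq_inner_gradient (X : Π x : M, TangentSpace I x) (f : M → ℝ) (x : M) :
    dir X f x = inner ℝ (gradient I f x) (X x) := (inner_gradient f x (X x)).symm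

theorem gradient_eq_of_dir (h : ∀ X : Π x : M, TangentSpace I x, CMDiff ∞ (T% X) →
    dir X f x = inner ℝ (W x) (X x)) : gradient I f x = W x := by
  refine ext_inner_right ℝ fun v ↦ ?_
  obtain ⟨X, hX, -, rfl⟩ := exists_contMDiff_eq (I := I) v
  rw [← dir_eq_inner_gradient, h X hX]

theorem contMDiff_gradient (hf : CMDiff ∞ f) : CMDiff ∞ (T% (gradient I f)) :=
  contMDiff_of_inner fun Z hZ ↦ by
    simp only [← dir_eq_inner_gradient]
    exact ContMDiff.dir hZ hf

/-- The Hessian is symmetric. -/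
theorem inner_cov_gradient_comm (hf : CMDiff ∞ f) (hX : CMDiff ∞ (T% X)) (hY : CMDiff ∞ (T% Y))
    (x : M) : inner ℝ (cov X (gradient I f) x) (Y x) = inner ℝ (cov Y (gradient I f) x) (X x) := by
  have hV := contMDiff_gradient hf
  have h := dir_mlieBracket hX hY hf x
  have e : ∀ A : Π x : M, TangentSpace I x, dir A f = fun y ↦ inner ℝ (gradient I f y) (A y) :=
    fun A ↦ funext fun y ↦ dir_eq_inner_gradient A f y
  rw [e Y, e X, dir_inner hX hV hY, dir_inner hY hV hX, dir_eq_inner_gradient,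
    ← cov_sub_cov hX hY, inner_sub_right] at h
  linarith

theorem inner_leviCivita_gradient_comm (hf : CMDiff ∞ f) (u v : TangentSpace I x) :
    inner ℝ (leviCivita I M (gradient I f) x u) v =
      inner ℝ (leviCivita I M (gradient I f) x v) u := by
  obtain ⟨X, hX, -, rfl⟩ := exists_contMDiff_eq (I := I) u
  obtain ⟨Y, hY, -, rfl⟩ := exists_contMDiff_eq (I := I) v
  exact inner_cov_gradient_comm hf hX hY x

/-- The bilinear form `(u, v) ↦ g(∇_u Y, v)`. -/
def covForm (Y : Π x : M, TangentSpace I x) (x : M) :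
    TangentSpace I x →ₗ[ℝ] TangentSpace I x →ₗ[ℝ] ℝ :=
  LinearMap.mk₂ ℝ (fun u v ↦ inner ℝ (leviCivita I M Y x u) v)
    (fun u u' z ↦ by rw [map_add, inner_add_left])
    (fun c u z ↦ by rw [map_smul, inner_smul_left]; rfl)
    (fun u z z' ↦ inner_add_right _ _ _)
    (fun c u z ↦ inner_smul_right _ _ _)

theorem laplacian_eq_sum {e : Fin (Module.finrank ℝ E) → TangentSpace I x} (he : Orthonormal ℝ e)
    (f : M → ℝ) :
    laplacian I f x = - ∑ i, inner ℝ (leviCivita I M (gradient I f) x (e i)) (e i) := by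
  rw [laplacian]
  congr 1
  exact metricTrace_eq_sum he (covForm (gradient I f) x)

theorem dir_sum {ι : Type*} (s : Finset ι) {F : ι → M → ℝ} (hF : ∀ i, CMDiff ∞ (F i)) (x : M) :
    dir X (fun y ↦ ∑ i ∈ s, F i y) x = ∑ i ∈ s, dir X (F i) x := by
  induction s using Finset.cons_induction with
  | empty => simpa using dir_const (X := X) 0 x
  | cons i s hi ih =>
    simp only [Finset.sum_cons]
    rw [dir_add (hF i) (contMDiff_finsetSum fun j _ ↦ hF j), ih]

/-- Differentiate the constants `g(eᵢ, eⱼ) = δᵢⱼ`. With `sum_bilin_skew`, this removes the error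
terms of a frame that is not parallel at `x`. -/
theorem inner_cov_frame_skew {ι : Type*} {e : ι → Π x : M, TangentSpace I x}
    (hV : CMDiff ∞ (T% V)) (he : ∀ i, CMDiff ∞ (T% (e i)))
    (heo : ∀ᶠ y in 𝓝 x, Orthonormal ℝ (fun i ↦ e i y)) (i j : ι) :
    inner ℝ (cov V (e i) x) (e j x) + inner ℝ (e i x) (cov V (e j) x) = 0 := by
  classical
  rw [← dir_inner hV (he i) (he j),
    dir_congr (g := fun _ ↦ if i = j then (1 : ℝ) else 0) ?_, dir_const]
  filter_upwards [heo] with y hy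
  exact orthonormal_iff_ite.1 hy i j

/-! ### Bochner's formula. -/

theorem gradient_norm_sq_add_sq (hf : CMDiff ∞ f) (x : M) :
    gradient I (fun y : M ↦ inner ℝ (gradient I f y) (gradient I f y) + f y * f y) x =
      ((fun _ : M ↦ (2 : ℝ)) • (cov (gradient I f) (gradient I f) + f • gradient I f)) x := by
  have hV := contMDiff_gradient hf
  refine gradient_eq_of_dir fun X hX ↦ ?_
  rw [dir_add (g := fun y ↦ f y * f y) (contMDiff_inner hV hV) (hf.mul hf), dir_mul hf hf, dir_inner hX hV hV,
    dir_eq_inner_gradient X f]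
  have h := inner_cov_gradient_comm hf hX hV x
  rw [real_inner_comm (cov X (gradient I f) x), h]
  simp only [Pi.smul_apply', Pi.add_apply, inner_smul_left, inner_add_left]
  simp
  ring

/-- A form of the Bochner formula for an eigenfunction of the Laplacian. -/
theorem laplacian_norm_sq_add_sq (hf : CMDiff ∞ f)
    (hΔ : ∀ y : M, laplacian I f y = (Module.finrank ℝ E : ℝ) * f y) (x : M) :
    ∃ b : Fin (Module.finrank ℝ E) → TangentSpace I x, Orthonormal ℝ b ∧
    laplacian I (fun y : M ↦ inner ℝ (gradient I f y) (gradient I f y) + f y * f y) x =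
      -2 * ((ricci x (gradient I f x) (gradient I f x) - ((Module.finrank ℝ E : ℝ) - 1) *
          inner ℝ (gradient I f x) (gradient I f x)) +
        ∑ i, inner ℝ (leviCivita I M (gradient I f) x (b i) + f x • b i)
          (leviCivita I M (gradient I f) x (b i) + f x • b i)) := by
  obtain ⟨e, he, heo⟩ := exists_orthonormal_frame (I := I) x
  have hex := heo.self_of_nhds
  refine ⟨fun i ↦ e i x, hex, ?_⟩
  set n : ℝ := (Module.finrank ℝ E : ℝ) with hn
  have hV := contMDiff_gradient hf
  set V := gradient I f with hVdef
  have hVV := contMDiff_cov hV hV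
  have hW : CMDiff ∞ (T% (cov V V + f • V)) := hVV.add_section (hf.smul_section hV)
  have hgrad : gradient I (fun y : M ↦ inner ℝ (V y) (V y) + f y * f y) =
      (fun _ : M ↦ (2 : ℝ)) • (cov V V + f • V) := funext fun y ↦ gradient_norm_sq_add_sq hf y
  have hc2 : CMDiff ∞ (fun _ : M ↦ (2 : ℝ)) := contMDiff_const
  rw [laplacian_eq_sum hex, hgrad]
  -- Commuting `∇_{eᵢ}` with `∇_V` produces the curvature; the bracket `[eᵢ,V]` is rewritten by
  -- vanishing torsion and the symmetry of the Hessian.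
  have term : ∀ i, inner ℝ (cov (e i) ((fun _ : M ↦ (2 : ℝ)) • (cov V V + f • V)) x) (e i x) =
      2 * (inner ℝ (curvatureAt x (e i x) (V x) (V x)) (e i x)
        + dir V (fun y : M ↦ inner ℝ (cov (e i) V y) (e i y)) x
        + inner ℝ (cov (e i) V x) (cov (e i) V x)
        - 2 * inner ℝ (cov (e i) V x) (cov V (e i) x)
        + f x * inner ℝ (cov (e i) V x) (e i x)
        + inner ℝ (V x) (e i x) * inner ℝ (e i x) (V x)) := by
    intro i
    have hi := he i
    have hiV := contMDiff_cov hi hV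
    rw [cov_smul hc2 hW, dir_const, zero_smul, add_zero, cov_add hVV (hf.smul_section hV),
      cov_smul hf hV, dir_inner hV hiV hi, curvatureAt_eq hi hV hV]
    have h1 : curvature (I := I) (e i) V V x = cov (e i) (cov V V) x - cov V (cov (e i) V) x -
      cov (mlieBracket I (e i) V) V x := rfl
    have h2 := inner_cov_gradient_comm hf (contMDiff_mlieBracket hi hV) hi x
    rw [← cov_sub_cov hi hV x, inner_sub_right] at h2
    rw [h1, dir_eq_inner_gradient (e i) f]
    simp only [inner_add_left, inner_sub_left, inner_smul_left,
      real_inner_comm (V x) (e i x)]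
    simp only [conj_trivial, ← hVdef]
    rw [h2]
    ring
  have hskew := sum_bilin_skew hex (card_fin_finrank x) (inner_cov_frame_skew hV he heo)
    (covForm V x)
  -- The skew-rotation sum has two equal halves because the Hessian is symmetric.
  have hskew' : ∑ i, inner ℝ (cov (e i) V x) (cov V (e i) x) = 0 := by
    have : ∀ i, covForm V x (cov V (e i) x) (e i x) + covForm V x (e i x) (cov V (e i) x) =
        2 * inner ℝ (cov (e i) V x) (cov V (e i) x) := by
      intro i
      have h := inner_leviCivita_gradient_comm hf (cov V (e i) x) (e i x)
      change inner ℝ (leviCivita I M V x (cov V (e i) x)) (e i x) +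
        inner ℝ (leviCivita I M V x (e i x)) (cov V (e i) x) = _
      rw [h, two_mul]
      rfl
    simp only [this, ← Finset.mul_sum] at hskew
    linarith
  -- The eigenvalue equation is kept on a neighbourhood, since the trace is differentiated along `V`
  -- next.
  have htr : ∀ᶠ y in 𝓝 x, ∑ i, inner ℝ (cov (e i) V y) (e i y) = (fun _ ↦ -n) y * f y := by
    filter_upwards [heo] with y hy
    have := laplacian_eq_sum hy f
    rw [hΔ y] at this
    change ∑ i, inner ℝ (leviCivita I M (gradient I f) y (e i y)) (e i y) = -n * f y
    linarith
  have hdtr : ∑ i, dir V (fun y : M ↦ inner ℝ (cov (e i) V y) (e i y)) x =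
      - n * inner ℝ (V x) (V x) := by
    rw [← dir_sum _ fun i ↦ contMDiff_inner (contMDiff_cov (he i) hV) (he i), dir_congr htr,
      dir_mul contMDiff_const hf, dir_const, dir_eq_inner_gradient V f]
    ring
  have hsq : ∀ i, inner ℝ (leviCivita I M V x (e i x) + f x • e i x)
      (leviCivita I M V x (e i x) + f x • e i x) =
      inner ℝ (cov (e i) V x) (cov (e i) V x) + 2 * f x * inner ℝ (cov (e i) V x) (e i x) +
        f x * f x := by
    intro i
    have h1 : inner ℝ (e i x) (e i x) = (1 : ℝ) := by
      rw [real_inner_self_eq_norm_sq, hex.1 i, one_pow]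
    change inner ℝ (cov (e i) V x + f x • e i x) (cov (e i) V x + f x • e i x) = _
    simp only [inner_add_left, inner_add_right, inner_smul_left, inner_smul_right, h1,
      real_inner_comm (cov (e i) V x) (e i x), conj_trivial]
    ring
  change - ∑ i, inner ℝ (cov (e i) ((fun _ : M ↦ (2 : ℝ)) • (cov V V + f • V)) x) (e i x) = _
  have htrx : ∑ i, inner ℝ (cov (e i) V x) (e i x) = -n * f x := htr.self_of_nhds
  simp only [term, hsq, ricci_eq_sum hex, ← Finset.mul_sum, Finset.sum_add_distrib,
    Finset.sum_sub_distrib, hskew', hdtr, htrx,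
    sum_inner_mul_inner_eq hex (card_fin_finrank x), Finset.sum_const, Finset.card_univ,
    Fintype.card_fin, nsmul_eq_mul, ← hn]
  ring

/-! ### The strong maximum principle. -/

theorem hasDerivAt_comp_curve {γ : ℝ → M} {t : ℝ}
    {D : TangentSpace 𝓘(ℝ, ℝ) t →L[ℝ] TangentSpace I (γ t)}
    (hγ : HasMFDerivAt 𝓘(ℝ, ℝ) I γ t D) (hf : MDiffAt f (γ t)) :
    HasDerivAt (f ∘ γ) (d% f (γ t) (D (1 : ℝ))) t := by
  have key : ∀ A : ℝ →L[ℝ] ℝ, HasFDerivAt (f ∘ γ) A t → HasDerivAt (f ∘ γ) (A 1) t :=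
    fun A h ↦ h.hasDerivAt
  exact key _ (hf.hasMFDerivAt.comp t hγ).hasFDerivAt

/-- Along an integral curve, iterated derivatives along `X` become ordinary ones, so the
one-variable tests apply at a local maximum. -/
theorem exists_curve_hasDerivAt [BoundarylessManifold I M] (hX : CMDiff ∞ (T% X)) (x : M) :
    ∃ γ : ℝ → M, γ 0 = x ∧ ContinuousAt γ 0 ∧ ∀ f : M → ℝ, CMDiff ∞ f →
      ∀ᶠ t in 𝓝 0, HasDerivAt (f ∘ γ) (dir X f (γ t)) t := by
  obtain ⟨γ, hγ0, hγ⟩ := exists_isMIntegralCurveAt_of_contMDiffAt_boundaryless (I := I) 0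
    ((hX x).of_le ENat.LEInfty.out)
  have hγ' : ∀ᶠ t in 𝓝 (0 : ℝ), HasMFDerivAt 𝓘(ℝ, ℝ) I γ t
    ((1 : ℝ →L[ℝ] ℝ).smulRight <| X (γ t)) := hγ
  refine ⟨γ, hγ0, hγ'.self_of_nhds.continuousAt, fun f hf ↦ ?_⟩
  filter_upwards [hγ'] with t ht
  have h := hasDerivAt_comp_curve ht (mdiffAt_fun hf (γ t))
  have e : X (γ t) =
      ((1 : ℝ →L[ℝ] ℝ).smulRight (X (γ t)) : ℝ →L[ℝ] TangentSpace I (γ t)) 1 := by simp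
  rw [dir, e]
  exact h

theorem dir_eq_zero_of_isLocalMax [BoundarylessManifold I M] (hf : CMDiff ∞ f)
    (hX : CMDiff ∞ (T% X)) (hmax : IsLocalMax f x) : dir X f x = 0 := by
  obtain ⟨γ, rfl, hγc, hγ⟩ := exists_curve_hasDerivAt hX x
  have h : IsLocalMax (f ∘ γ) 0 := hmax.comp_tendsto hγc
  exact h.hasDerivAt_eq_zero (hγ f hf).self_of_nhds

theorem dir_dir_nonpos_of_isLocalMax [BoundarylessManifold I M] (hf : CMDiff ∞ f)
    (hX : CMDiff ∞ (T% X)) (hmax : IsLocalMax f x) : dir X (dir X f) x ≤ 0 := by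
  obtain ⟨γ, rfl, hγc, hγ⟩ := exists_curve_hasDerivAt hX x
  exact nonpos_of_isLocalMax_of_hasDerivAt (hγ f hf)
    (hγ (dir X f) (ContMDiff.dir hX hf)).self_of_nhds (hmax.comp_tendsto hγc : IsLocalMax (f ∘ γ) 0)

/-- At a critical point the correction `(∇_{eᵢ}eᵢ) f` vanishes, so each diagonal Hessian entry is
`eᵢ eᵢ f ≤ 0`. -/
theorem laplacian_nonneg_of_isLocalMax [BoundarylessManifold I M] (hf : CMDiff ∞ f)
    (hmax : IsLocalMax f x) : 0 ≤ laplacian I f x := by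
  have hV := contMDiff_gradient hf
  obtain ⟨e, he, heo⟩ := exists_orthonormal_frame (I := I) x
  rw [laplacian_eq_sum heo.self_of_nhds, neg_nonneg]
  refine Finset.sum_nonpos fun i _ ↦ ?_
  have h1 := dir_inner (he i) hV (he i) x
  have h2 : dir (e i) f = fun y : M ↦ inner ℝ (gradient I f y) (e i y) :=
    funext fun y ↦ dir_eq_inner_gradient _ _ _
  have h3 := dir_dir_nonpos_of_isLocalMax hf (he i) hmax
  have h4 := dir_eq_zero_of_isLocalMax hf (contMDiff_cov (he i) (he i)) hmax
  rw [dir_eq_inner_gradient] at h4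
  rw [h2, h1, h4, add_zero] at h3
  exact h3

theorem contMDiff_laplacian (hf : CMDiff ∞ f) : CMDiff ∞ (laplacian I f) := by
  intro x
  obtain ⟨e, he, heo⟩ := exists_orthonormal_frame (I := I) x
  have hV := contMDiff_gradient hf
  have h : CMDiff ∞ (fun y : M ↦ - ∑ i, inner ℝ (cov (e i) (gradient I f) y) (e i y)) :=
    (contMDiff_finsetSum fun i _ ↦ contMDiff_inner (contMDiff_cov (he i) hV) (he i)).neg
  refine (h x).congr_of_eventuallyEq ?_
  filter_upwards [heo] with y hy
  exact laplacian_eq_sum hy f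

theorem laplacian_add_const_mul (hu : CMDiff ∞ u) (hv : CMDiff ∞ v) (c : ℝ) (x : M) :
    laplacian I (fun y ↦ u y + c * v y) x = laplacian I u x + c * laplacian I v x := by
  have hc : CMDiff ∞ (fun _ : M ↦ c) := contMDiff_const
  have hg : gradient I (fun y ↦ u y + c * v y) =
      gradient I u + (fun _ : M ↦ c) • gradient I v := by
    funext y
    refine gradient_eq_of_dir fun X hX ↦ ?_
    rw [dir_add (g := fun y ↦ c * v y) hu (hc.mul hv), dir_mul hc hv, dir_const]
    simp [inner_add_left, inner_smul_left, dir_eq_inner_gradient]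
  obtain ⟨e, he, heo⟩ := exists_orthonormal_frame (I := I) x
  have hex := heo.self_of_nhds
  rw [laplacian_eq_sum hex, laplacian_eq_sum hex, laplacian_eq_sum hex, hg, mul_neg, ← neg_add,
    Finset.mul_sum, ← Finset.sum_add_distrib]
  congr 1
  refine Finset.sum_congr rfl fun i _ ↦ ?_
  change inner ℝ (cov (e i) (gradient I u + (fun _ : M ↦ c) • gradient I v) x) (e i x) =
    inner ℝ (cov (e i) (gradient I u) x) (e i x) + c * inner ℝ (cov (e i) (gradient I v) x) (e i x)
  rw [cov_add (contMDiff_gradient hu) (hc.smul_section (contMDiff_gradient hv)),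
    cov_smul hc (contMDiff_gradient hv), dir_const]
  simp [inner_add_left, inner_smul_left]

theorem contMDiff_real_comp {φ : ℝ → ℝ} (hφ : ContDiff ℝ ∞ φ) (hf : CMDiff ∞ f) :
    CMDiff ∞ (fun y : M ↦ φ (f y)) := hφ.contMDiff.comp hf

theorem dir_comp {φ : ℝ → ℝ} {φ' : ℝ} (hφ : HasDerivAt φ φ' (f x)) (hf : CMDiff ∞ f) :
    dir X (fun y ↦ φ (f y)) x = φ' * dir X f x := by
  have h1 := (hφ.hasFDerivAt.hasMFDerivAt).comp x (mdiffAt_fun hf x).hasMFDerivAt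
  have h2 : mfderiv I 𝓘(ℝ, ℝ) (fun y ↦ φ (f y)) x = _ := h1.mfderiv
  rw [dir, mvfderiv, h2]
  exact mul_comm _ _

/-- Hopf's barrier: at a point where `∇ρ ≠ 0`, a large `α` makes this Laplacian negative. -/
theorem laplacian_exp_neg (hρ : CMDiff ∞ ρ) (α : ℝ) (x : M) :
    laplacian I (fun y ↦ Real.exp (-α * ρ y)) x = - (α * Real.exp (-α * ρ x) *
      (laplacian I ρ x + α * inner ℝ (gradient I ρ x) (gradient I ρ x))) := by
  have hexp : ∀ t : ℝ, HasDerivAt (fun s ↦ Real.exp (-α * s)) (-α * Real.exp (-α * t)) t := by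
    intro t
    have := ((hasDerivAt_id t).const_mul (-α)).exp
    simpa [mul_comm] using this
  have hE : CMDiff ∞ (fun y : M ↦ Real.exp (-α * ρ y)) :=
    contMDiff_real_comp (φ := fun s ↦ Real.exp (-α * s)) (by fun_prop) hρ
  have hc : CMDiff ∞ (fun _ : M ↦ -α) := contMDiff_const
  have hcE : CMDiff ∞ (fun y : M ↦ -α * Real.exp (-α * ρ y)) := hc.mul hE
  have hG := contMDiff_gradient hρ
  have hg : gradient I (fun y ↦ Real.exp (-α * ρ y)) =
      (fun y : M ↦ -α * Real.exp (-α * ρ y)) • gradient I ρ := by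
    funext y
    refine gradient_eq_of_dir fun X hX ↦ ?_
    rw [dir_comp (hexp (ρ y)) hρ, dir_eq_inner_gradient, Pi.smul_apply', inner_smul_left]
    rfl
  obtain ⟨e, he, heo⟩ := exists_orthonormal_frame (I := I) x
  have hex := heo.self_of_nhds
  rw [laplacian_eq_sum hex, laplacian_eq_sum hex, hg, neg_inj,
    ← sum_inner_mul_inner_eq hex (card_fin_finrank x), Finset.mul_sum, ← Finset.sum_neg_distrib,
    ← Finset.sum_add_distrib, Finset.mul_sum]
  refine Finset.sum_congr rfl fun i _ ↦ ?_
  change inner ℝ (cov (e i) ((fun y : M ↦ -α * Real.exp (-α * ρ y)) • gradient I ρ) x) (e i x) =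
    α * Real.exp (-α * ρ x) * (-inner ℝ (cov (e i) (gradient I ρ) x) (e i x) + _)
  rw [cov_smul hcE hG, dir_mul hc hE, dir_const, dir_comp (hexp (ρ x)) hρ, dir_eq_inner_gradient,
    inner_add_left, inner_smul_left, inner_smul_left, real_inner_comm (gradient I ρ x) (e i x)]
  simp only [conj_trivial]
  ring

/-- At some boundary point of a closed set there is a smooth function, regular at that point,
which has a strict local minimum there relative to the set. -/
theorem exists_touching_function [I.Boundaryless] {K : Set M} (hK : IsClosed K) {x₁ : M}
    (hx₁ : x₁ ∈ K) (hint : x₁ ∉ interior K) :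
    ∃ x₀ ∈ K, ∃ ρ : M → ℝ, CMDiff ∞ ρ ∧ gradient I ρ x₀ ≠ 0 ∧
      ∀ᶠ q in 𝓝 x₀, q ∈ K → q ≠ x₀ → ρ x₀ < ρ q := by
  let c := extChartAt I x₁
  let L : E ≃L[ℝ] EuclideanSpace ℝ (Fin (Module.finrank ℝ E)) := toEuclidean
  let j : M → EuclideanSpace ℝ (Fin (Module.finrank ℝ E)) := fun q ↦ L (c q)
  let k : EuclideanSpace ℝ (Fin (Module.finrank ℝ E)) → M := fun p ↦ c.symm (L.symm p)
  have hkj : ∀ q ∈ c.source, k (j q) = q := fun q hq ↦ by simp [k, j, c.left_inv hq]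
  let T : Set (EuclideanSpace ℝ (Fin (Module.finrank ℝ E))) := L.symm ⁻¹' c.target
  have hT : IsOpen T := (isOpen_extChartAt_target x₁).preimage L.symm.continuous
  have hjk : ∀ p ∈ T, j (k p) = p := fun p hp ↦ by
    simp [k, j, c.right_inv (show L.symm p ∈ c.target from hp)]
  have hkT : ∀ p ∈ T, k p ∈ c.source := fun p hp ↦ c.map_target hp
  have hkc : ContinuousOn k T :=
    (continuousOn_extChartAt_symm x₁).comp L.symm.continuous.continuousOn fun p hp ↦ hp
  have hcs : IsOpen c.source := isOpen_extChartAt_source x₁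
  have hjs : CMDiff[c.source] ∞ j := by
    have h1 : CMDiff[c.source] ∞ c := by
      simpa [c, extChartAt_source] using contMDiffOn_extChartAt (I := I) (x := x₁) (n := ∞)
    exact L.contDiff.contMDiff.comp_contMDiffOn h1
  have hjc : ContinuousOn j c.source := hjs.continuousOn
  have hx₁s : x₁ ∈ c.source := mem_extChartAt_source x₁
  have hjT : ∀ q ∈ c.source, j q ∈ T := fun q hq ↦ by simp [T, j, c.map_source hq]
  obtain ⟨r', hr', hball⟩ := Metric.nhds_basis_closedBall.mem_iff.1 (hT.mem_nhds (hjT x₁ hx₁s))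
  -- The factor `3` keeps the nearest point inside the ball: with `y` within `r` of the centre, a
  -- point of `K'` nearest to `y` is within `2r` of it.
  obtain ⟨r, hr, hr3⟩ : ∃ r > 0, 3 * r = r' := ⟨r' / 3, by positivity, by ring⟩
  subst hr3
  let K' := Metric.closedBall (j x₁) (3 * r) ∩ k ⁻¹' K
  have hK' : IsCompact K' := by
    refine (isCompact_closedBall (j x₁) (3 * r)).of_isClosed_subset ?_ inter_subset_left
    exact (hkc.mono hball).preimage_isClosed_of_isClosed Metric.isClosed_closedBall hK
  have hx₁K' : j x₁ ∈ K' :=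
    ⟨Metric.mem_closedBall_self hr'.le, by simpa [hkj x₁ hx₁s] using hx₁⟩
  have hjat : ∀ q ∈ c.source, ContinuousAt j q := fun q hq ↦
    hjc.continuousAt (hcs.mem_nhds hq)
  obtain ⟨q, ⟨hqs, hqr⟩, hqK⟩ : ∃ q ∈ c.source ∩ j ⁻¹' Metric.ball (j x₁) r, q ∉ K := by
    by_contra! h
    exact hint (mem_interior_iff_mem_nhds.2 (mem_of_superset (inter_mem (hcs.mem_nhds hx₁s)
      ((hjat x₁ hx₁s) (Metric.ball_mem_nhds _ hr))) h))
  set y := j q with hy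
  have hqr' : dist y (j x₁) < r := hqr
  obtain ⟨z, hzK', hz⟩ := hK'.exists_isMinOn ⟨_, hx₁K'⟩
    (f := fun p ↦ dist p y) (by fun_prop)
  have hzmin : ∀ p ∈ K', dist z y ≤ dist p y := fun p hp ↦ hz hp
  have hzT : z ∈ T := hball hzK'.1
  have hyz : z ≠ y := by
    rintro h
    apply hqK
    have := hzK'.2
    rw [h] at this
    simpa [hy, hkj q hqs] using this
  have hzx : dist z (j x₁) < 3 * r := by
    have h1 := hzmin _ hx₁K'
    rw [dist_comm (j x₁)] at h1
    have := dist_triangle z y (j x₁)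
    linarith
  have hx₀s := hkT z hzT
  have hjx₀ : j (k z) = z := hjk z hzT
  -- The first term is minimal on `K'` at `z`; the second makes the minimum strict without changing
  -- the differential at `z`, which is nonzero as `z ≠ y`.
  let ρ₀ : M → ℝ := fun p ↦ ‖j p - y‖ ^ 2 + ‖j p - z‖ ^ 2
  have hρ₀ : CMDiff[c.source] ∞ ρ₀ := by
    have h : ContDiff ℝ ∞ (fun p : EuclideanSpace ℝ (Fin (Module.finrank ℝ E)) ↦
        ‖p - y‖ ^ 2 + ‖p - z‖ ^ 2) :=
      ((contDiff_id.sub contDiff_const).norm_sq ℝ).add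
        ((contDiff_id.sub contDiff_const).norm_sq ℝ)
    exact h.contMDiff.comp_contMDiffOn hjs
  obtain ⟨ψ, -, hψ⟩ := (SmoothBumpFunction.nhds_basis_tsupport (I := I) (k z)).mem_iff.1
    (hcs.mem_nhds hx₀s)
  let ρ : M → ℝ := fun p ↦ ψ p • ρ₀ p
  have hρ : CMDiff ∞ ρ := by
    refine contMDiff_of_tsupport fun p hp ↦ ?_
    have hp' : p ∈ c.source := hψ (tsupport_smul_subset_left _ _ hp)
    exact ψ.contMDiffAt.smul ((hρ₀ p hp').contMDiffAt (hcs.mem_nhds hp'))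
  have hρeq : ∀ᶠ p in 𝓝 (k z), ρ p = ρ₀ p := by
    filter_upwards [ψ.eventuallyEq_one] with p hp
    simp [ρ, hp]
  refine ⟨k z, hzK'.2, ρ, hρ, ?_, ?_⟩
  · intro hgrad
    -- Along the ray from `y` through `z`, `ρ` has derivative `2‖z - y‖² > 0` at `z`.
    let l : ℝ → EuclideanSpace ℝ (Fin (Module.finrank ℝ E)) := fun t ↦ z + t • (z - y)
    have hl0 : l 0 = z := by simp [l]
    have hlc : ContinuousAt l 0 := by fun_prop
    have hγ : MDifferentiableAt 𝓘(ℝ, ℝ) I (k ∘ l) 0 := by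
      have h1 : MDifferentiableAt 𝓘(ℝ, E) I c.symm (L.symm z) :=
        (((contMDiffOn_extChartAt_symm (n := ∞) x₁) (L.symm z) hzT).contMDiffAt
          ((isOpen_extChartAt_target x₁).mem_nhds hzT)).mdifferentiableAt (by simp)
      have h2 : MDifferentiableAt 𝓘(ℝ, ℝ) 𝓘(ℝ, E) (fun t ↦ L.symm (l t)) 0 := by
        apply DifferentiableAt.mdifferentiableAt
        fun_prop
      have h3 : MDifferentiableAt 𝓘(ℝ, E) I c.symm ((fun t ↦ L.symm (l t)) 0) := by
        simpa only [hl0] using h1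
      exact MDifferentiableAt.comp (g := c.symm) (f := fun t ↦ L.symm (l t)) 0 h3 h2
    have hcomp : HasDerivAt (ρ ∘ (k ∘ l)) 0 0 := by
      have h := hasDerivAt_comp_curve hγ.hasMFDerivAt (mdiffAt_fun hρ _)
      rw [← inner_gradient] at h
      have h0 : gradient I ρ ((k ∘ l) 0) = 0 := by
        rw [Function.comp_apply, hl0, hgrad]
      rwa [h0, inner_zero_left] at h
    have heq : (ρ ∘ (k ∘ l)) =ᶠ[𝓝 0] fun t ↦ (1 + t) ^ 2 * ‖z - y‖ ^ 2 + t ^ 2 * ‖z - y‖ ^ 2 := by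
      have hkcont : ContinuousAt (k ∘ l) 0 := hγ.continuousAt
      have e1 : ∀ᶠ t in 𝓝 (0 : ℝ), ρ ((k ∘ l) t) = ρ₀ ((k ∘ l) t) := by
        have h : ∀ᶠ p in 𝓝 ((k ∘ l) 0), ρ p = ρ₀ p := by
          rw [Function.comp_apply, hl0]
          exact hρeq
        exact hkcont.eventually h
      have e2 : ∀ᶠ t in 𝓝 (0 : ℝ), l t ∈ T := hlc (hT.mem_nhds (by rwa [hl0]))
      filter_upwards [e1, e2] with t h1 h2
      have h3 : l t - y = (1 + t) • (z - y) := by simp only [l]; module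
      have h4 : l t - z = t • (z - y) := by simp only [l]; module
      rw [Function.comp_apply, h1]
      simp only [ρ₀, Function.comp_apply, hjk _ h2, h3, h4, norm_smul, mul_pow, Real.norm_eq_abs,
        sq_abs]
    have hpoly : HasDerivAt (fun t : ℝ ↦ (1 + t) ^ 2 * ‖z - y‖ ^ 2 + t ^ 2 * ‖z - y‖ ^ 2)
        (2 * ‖z - y‖ ^ 2) 0 := by
      have h1 := (((hasDerivAt_id (0 : ℝ)).const_add 1).pow 2).mul_const (‖z - y‖ ^ 2)
      have h2 := ((hasDerivAt_id (0 : ℝ)).pow 2).mul_const (‖z - y‖ ^ 2)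
      exact (h1.add h2).congr_deriv (by simp)
    have h0 := (hcomp.congr_of_eventuallyEq heq.symm).unique hpoly
    have : 0 < ‖z - y‖ := norm_pos_iff.2 (sub_ne_zero.2 hyz)
    nlinarith
  · have hjz := hjat _ hx₀s
    have e1 : ∀ᶠ p in 𝓝 (k z), j p ∈ Metric.ball (j x₁) (3 * r) :=
      hjz (Metric.isOpen_ball.mem_nhds (by rw [hjx₀]; exact hzx))
    filter_upwards [e1, hcs.mem_nhds hx₀s, hρeq] with p hp1 hp2 hp3 hpK hpne
    rw [hρeq.self_of_nhds, hp3]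
    have hpK' : j p ∈ K' := ⟨Metric.ball_subset_closedBall hp1, by simpa [hkj p hp2] using hpK⟩
    have h1 := hzmin _ hpK'
    rw [dist_eq_norm, dist_eq_norm] at h1
    have h2 : 0 < ‖j p - z‖ := by
      refine norm_pos_iff.2 (sub_ne_zero.2 fun h ↦ hpne ?_)
      rw [← h, hkj p hp2]
    simp only [ρ₀, hjx₀, sub_self, norm_zero]
    have h3 : ‖z - y‖ ^ 2 ≤ ‖j p - y‖ ^ 2 := by gcongr
    have h4 : 0 < ‖j p - z‖ ^ 2 := by positivity
    linarith

/-- The strong maximum principle: a subharmonic function on a closed connected manifold is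
constant. -/
theorem eq_of_laplacian_nonpos [I.Boundaryless] [CompactSpace M] [ConnectedSpace M]
    (hu : CMDiff ∞ u) (hΔ : ∀ y : M, laplacian I u y ≤ 0) (y z : M) : u y = u z := by
  have hE : LocallyCompactSpace M := Manifold.locallyCompact_of_finiteDimensional I
  have huc : Continuous u := hu.continuous
  obtain ⟨m, -, hm⟩ := isCompact_univ.exists_isMaxOn (univ_nonempty (α := M)) huc.continuousOn
  have hm' : ∀ q, u q ≤ u m := fun q ↦ hm (mem_univ q)
  let K : Set M := {q | u q = u m}
  have hK : IsClosed K := isClosed_eq huc continuous_const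
  suffices h : K = univ by
    have hy : y ∈ K := h ▸ mem_univ y
    have hz : z ∈ K := h ▸ mem_univ z
    exact hy.trans hz.symm
  by_contra hne
  obtain ⟨x₁, hx₁K, hx₁⟩ : ∃ x₁ ∈ K, x₁ ∉ interior K := by
    by_contra! h
    have hopen : IsOpen K := subset_interior_iff_isOpen.1 h
    rcases isClopen_iff.1 ⟨hK, hopen⟩ with h | h
    · exact (h ▸ (rfl : u m = u m) : m ∈ (∅ : Set M))
    · exact hne h
  obtain ⟨x₀, hx₀, ρ, hρ, hgrad, hstrict⟩ := exists_touching_function (I := I) hK hx₁K hx₁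
  have hG : 0 < inner ℝ (gradient I ρ x₀) (gradient I ρ x₀) := real_inner_self_pos.2 hgrad
  -- Take `α` so that `α|∇ρ|² = |Δρ| + 1` at `x₀`.
  obtain ⟨α, hα, hα'⟩ : ∃ α : ℝ, 0 < α ∧
      0 < laplacian I ρ x₀ + α * inner ℝ (gradient I ρ x₀) (gradient I ρ x₀) := by
    refine ⟨(|laplacian I ρ x₀| + 1) / inner ℝ (gradient I ρ x₀) (gradient I ρ x₀), by positivity,
      ?_⟩
    rw [div_mul_cancel₀ _ hG.ne']
    linarith [neg_abs_le (laplacian I ρ x₀)]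
  let v : M → ℝ := fun q ↦ Real.exp (-α * ρ q)
  have hv : CMDiff ∞ v :=
    contMDiff_real_comp (φ := fun s ↦ Real.exp (-α * s)) (by fun_prop) hρ
  have hLv : laplacian I v x₀ < 0 := by
    have := laplacian_exp_neg hρ α x₀
    have hpos : 0 < α * Real.exp (-α * ρ x₀) *
      (laplacian I ρ x₀ + α * inner ℝ (gradient I ρ x₀) (gradient I ρ x₀)) := by positivity
    change laplacian I (fun q ↦ Real.exp (-α * ρ q)) x₀ < 0
    linarith
  have hLvc : ∀ᶠ q in 𝓝 x₀, laplacian I v q < 0 :=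
    (contMDiff_laplacian hv).continuous.continuousAt.eventually_lt continuousAt_const hLv
  obtain ⟨B, hBx, hBsub, hBc⟩ := LocallyCompactSpace.local_compact_nhds x₀ _
    (hLvc.and hstrict)
  have hBcl : IsClosed B := hBc.isClosed
  -- Only the part of the frontier where the barrier is at least `v x₀` is dangerous. It misses `K`,
  -- because on `K` near `x₀` the barrier is strictly largest at `x₀`; so `u` stays below its
  -- maximum on the compact set `S`.
  let S : Set M := frontier B ∩ {q | v x₀ ≤ v q}
  have hS : IsCompact S := (hBc.of_isClosed_subset isClosed_frontier hBcl.frontier_subset).inter_right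
    (isClosed_le continuous_const hv.continuous)
  have hx₀int : x₀ ∈ interior B := mem_interior_iff_mem_nhds.2 hBx
  have hSK : ∀ q ∈ S, u q < u m := by
    intro q hq
    refine lt_of_le_of_ne (hm' q) fun hqK ↦ ?_
    have hqx : q ≠ x₀ := by
      rintro rfl
      exact hq.1.2 hx₀int
    have h1 : ρ x₀ < ρ q := (hBsub (hBcl.frontier_subset hq.1)).2 hqK hqx
    have h2 : v q < v x₀ := Real.exp_lt_exp.2 (by nlinarith)
    exact absurd hq.2 (not_le.2 h2)
  obtain ⟨ε, hε, hεS⟩ : ∃ ε > 0, ∀ q ∈ S, u q + ε * (v q - v x₀) < u m := by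
    rcases S.eq_empty_or_nonempty with hSe | hSne
    · exact ⟨1, one_pos, fun q hq ↦ by simp [hSe] at hq⟩
    obtain ⟨q₁, hq₁, hmax₁⟩ := hS.exists_isMaxOn hSne huc.continuousOn
    obtain ⟨q₂, hq₂, hmax₂⟩ := hS.exists_isMaxOn hSne hv.continuous.continuousOn
    have hδ : 0 < u m - u q₁ := sub_pos.2 (hSK q₁ hq₁)
    have hw : 0 ≤ v q₂ - v x₀ := sub_nonneg.2 hq₂.2
    refine ⟨(u m - u q₁) / (v q₂ - v x₀ + 1), by positivity, fun q hq ↦ ?_⟩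
    have h1 : u q ≤ u q₁ := hmax₁ hq
    have h2 : v q ≤ v q₂ := hmax₂ hq
    have h3 : (u m - u q₁) / (v q₂ - v x₀ + 1) * (v q - v x₀) < u m - u q₁ := by
      rw [div_mul_eq_mul_div, div_lt_iff₀ (by positivity)]
      nlinarith
    linarith
  let w : M → ℝ := fun q ↦ u q + ε * v q
  have hw : CMDiff ∞ w := hu.add (contMDiff_const.mul hv)
  obtain ⟨p, hpB, hpmax⟩ := hBc.exists_isMaxOn ⟨x₀, mem_of_mem_nhds hBx⟩ hw.continuous.continuousOn
  have hwx₀ : w x₀ ≤ w p := hpmax (mem_of_mem_nhds hBx)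
  have hux₀ : u x₀ = u m := hx₀
  -- On the frontier `w < w x₀`: on `S` by the choice of `ε`, and off `S` because `v < v x₀` and `u
  -- ≤ u m = u x₀`.
  have hpint : p ∈ interior B := by
    by_contra hp
    have hpf : p ∈ frontier B := ⟨subset_closure hpB, hp⟩
    have hlt : u p + ε * (v p - v x₀) < u m := by
      by_cases h : v x₀ ≤ v p
      · exact hεS p ⟨hpf, h⟩
      · have := hm' p
        have h' : v p - v x₀ < 0 := by linarith [not_le.1 h]
        nlinarith
    simp only [w] at hwx₀
    linarith
  have hloc : IsLocalMax w p := by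
    filter_upwards [mem_interior_iff_mem_nhds.1 hpint] with q hq using hpmax hq
  -- The contradiction: `Δw ≥ 0` at the interior maximum, but `Δu ≤ 0` and `Δv < 0` there.
  have h1 := laplacian_nonneg_of_isLocalMax hw hloc
  rw [laplacian_add_const_mul hu hv] at h1
  have h2 := hΔ p
  have h3 : laplacian I v p < 0 := (hBsub hpB).1
  nlinarith

/-! ### Rigidity: the equation `∇²f = -f g` and its curvature consequences. -/

/-- The hypotheses on an eigenfunction for the lowest possible eigenvalue force
`∇²f = -f g`, and `|∇f|² + f²` is constant. -/
theorem hessian_rigidity [I.Boundaryless] [CompactSpace M] [ConnectedSpace M]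
    (hRic : ∀ (x : M) (v : TangentSpace I x),
      ((Module.finrank ℝ E : ℝ) - 1) * inner ℝ v v ≤ ricci x v v)
    (hf : CMDiff ∞ f) (hΔ : ∀ y : M, laplacian I f y = (Module.finrank ℝ E : ℝ) * f y) :
    (∀ (x : M) (v : TangentSpace I x), leviCivita I M (gradient I f) x v = -(f x • v)) ∧
      ∃ c : ℝ, ∀ x : M, inner ℝ (gradient I f x) (gradient I f x) + f x * f x = c := by
  have hV := contMDiff_gradient hf
  let P : M → ℝ := fun y ↦ inner ℝ (gradient I f y) (gradient I f y) + f y * f y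
  have hP : CMDiff ∞ P := (contMDiff_inner hV hV).add (hf.mul hf)
  have hnn : ∀ (x : M) (b : Fin (Module.finrank ℝ E) → TangentSpace I x) (i),
      0 ≤ inner ℝ (leviCivita I M (gradient I f) x (b i) + f x • b i)
        (leviCivita I M (gradient I f) x (b i) + f x • b i) := fun x b i ↦ real_inner_self_nonneg
  have hsub : ∀ y : M, laplacian I P y ≤ 0 := by
    intro y
    obtain ⟨b, -, hbl⟩ := laplacian_norm_sq_add_sq hf hΔ y
    have h1 := hRic y (gradient I f y)
    have h2 := Finset.sum_nonneg fun i (_ : i ∈ Finset.univ) ↦ hnn y b i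
    change laplacian I P y = _ at hbl
    linarith
  have hconst : ∀ y z : M, P y = P z := eq_of_laplacian_nonpos hP hsub
  refine ⟨fun x v ↦ ?_, ?_⟩
  · obtain ⟨b, hb, hbl⟩ := laplacian_norm_sq_add_sq hf hΔ x
    -- Every point maximizes the constant `P`, so `0 ≤ ΔP`, and both nonnegative Bochner terms must
    -- vanish.
    have hmax : IsLocalMax P x := Eventually.of_forall fun y ↦ (hconst y x).le
    have h0 := laplacian_nonneg_of_isLocalMax hP hmax
    change laplacian I P x = _ at hbl
    have h1 := hRic x (gradient I f x)
    have h2 := Finset.sum_nonneg fun i (_ : i ∈ Finset.univ) ↦ hnn x b i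
    have h3 : ∑ i, inner ℝ (leviCivita I M (gradient I f) x (b i) + f x • b i)
        (leviCivita I M (gradient I f) x (b i) + f x • b i) = 0 := by linarith
    have h4 : ∀ i, leviCivita I M (gradient I f) x (b i) = -(f x • b i) := fun i ↦ by
      have := (Finset.sum_eq_zero_iff_of_nonneg fun j _ ↦ hnn x b j).1 h3 i (Finset.mem_univ i)
      exact eq_neg_of_add_eq_zero_left (inner_self_eq_zero.1 this)
    rw [← sum_inner_smul_eq hb (card_fin_finrank x) v]
    simp only [map_sum, map_smul, h4, Finset.smul_sum, ← Finset.sum_neg_distrib]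
    refine Finset.sum_congr rfl fun i _ ↦ ?_
    module
  · obtain ⟨m⟩ := (inferInstance : Nonempty M)
    exact ⟨P m, fun x ↦ hconst x m⟩

/-- Since `∇_A V = -f A`, the second derivatives of `V` are explicit; the terms in `f` cancel by
vanishing torsion, leaving the curvature of the unit sphere. -/
theorem curvature_gradient_right (hf : CMDiff ∞ f)
    (hHess : ∀ (x : M) (v : TangentSpace I x), leviCivita I M (gradient I f) x v = -(f x • v))
    (hX : CMDiff ∞ (T% X)) (hY : CMDiff ∞ (T% Y)) (x : M) :
    curvature (I := I) X Y (gradient I f) x =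
      (inner ℝ (gradient I f x) (Y x) : ℝ) • X x - (inner ℝ (gradient I f x) (X x) : ℝ) • Y x := by
  have h : ∀ A : Π x : M, TangentSpace I x, cov A (gradient I f) = -(f • A) := fun A ↦
    funext fun y ↦ hHess y (A y)
  rw [curvature_eq]
  simp only [h, Pi.sub_apply, Pi.neg_apply, Pi.smul_apply']
  rw [cov_neg (hf.smul_section hY), cov_neg (hf.smul_section hX), cov_smul hf hY, cov_smul hf hX,
    ← cov_sub_cov hX hY, dir_eq_inner_gradient, dir_eq_inner_gradient]
  module

theorem curvature_gradient_left (hf : CMDiff ∞ f)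
    (hHess : ∀ (x : M) (v : TangentSpace I x), leviCivita I M (gradient I f) x v = -(f x • v))
    (hX : CMDiff ∞ (T% X)) (hY : CMDiff ∞ (T% Y)) (x : M) :
    curvature (I := I) (gradient I f) X Y x =
      (inner ℝ (X x) (Y x) : ℝ) • gradient I f x - (inner ℝ (gradient I f x) (Y x) : ℝ) • X x := by
  refine ext_inner_right ℝ fun w ↦ ?_
  obtain ⟨W, hW, -, rfl⟩ := exists_contMDiff_eq (I := I) w
  rw [inner_curvature_pair (contMDiff_gradient hf) hX hY hW,
    curvature_gradient_right hf hHess hY hW]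
  simp only [inner_sub_left, inner_smul_left, conj_trivial]
  rw [real_inner_comm (X x) (Y x), real_inner_comm (X x) (W x)]
  ring

/-- The covariant derivative of the curvature tensor in the direction of the gradient. -/
theorem cov_gradient_curvature (hf : CMDiff ∞ f)
    (hHess : ∀ (x : M) (v : TangentSpace I x), leviCivita I M (gradient I f) x v = -(f x • v))
    (hX : CMDiff ∞ (T% X)) (hY : CMDiff ∞ (T% Y)) (hZ : CMDiff ∞ (T% Z)) (x : M) :
    cov (gradient I f) (curvature (I := I) X Y Z) x =
      curvatureAt x (X x) (Y x) (cov (gradient I f) Z x) +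
      curvatureAt x (X x) (cov (gradient I f) Y x) (Z x) +
      curvatureAt x (cov (gradient I f) X x) (Y x) (Z x) +
      (2 * f x) • (curvatureAt x (X x) (Y x) (Z x) -
        ((inner ℝ (Y x) (Z x) : ℝ) • X x - (inner ℝ (X x) (Z x) : ℝ) • Y x)) := by
  have hV := contMDiff_gradient hf
  set V := gradient I f with hVdef
  have hcV : ∀ A : Π x : M, TangentSpace I x, cov A V x = -(f x • A x) := fun A ↦ hHess x (A x)
  have hVZ := contMDiff_inner hV hZ
  have left : ∀ {A B : Π x : M, TangentSpace I x}, CMDiff ∞ (T% A) → CMDiff ∞ (T% B) → ∀ y,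
      curvature (I := I) V A B y = (inner ℝ (A y) (B y) : ℝ) • V y - (inner ℝ (V y) (B y) : ℝ) • A y :=
    fun hA hB y ↦ curvature_gradient_left hf hHess hA hB y
  -- Two of the three derivative terms in the second Bianchi identity contain `R(V,·)`, which is
  -- known explicitly.
  have covleft : ∀ {A B : Π x : M, TangentSpace I x}, CMDiff ∞ (T% A) → CMDiff ∞ (T% B) →
      cov B (curvature (I := I) V A Z) x - curvature (I := I) V A (cov B Z) x =
        (inner ℝ (cov B A x) (Z x) : ℝ) • V x - (f x * inner ℝ (A x) (Z x)) • B x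
          + (f x * inner ℝ (B x) (Z x)) • A x - (inner ℝ (V x) (Z x) : ℝ) • cov B A x := by
    intro A B hA hB
    have hAZ := contMDiff_inner hA hZ
    have h : curvature (I := I) V A Z =
        (fun y : M ↦ (inner ℝ (A y) (Z y) : ℝ)) • V - (fun y : M ↦ (inner ℝ (V y) (Z y) : ℝ)) • A :=
      funext fun y ↦ left hA hZ y
    rw [h, cov_sub (hAZ.smul_section hV) (hVZ.smul_section hA), cov_smul hAZ hV, cov_smul hVZ hA,
      left hA (contMDiff_cov hB hZ), dir_inner hB hA hZ, dir_inner hB hV hZ, hcV, inner_neg_left,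
      inner_smul_left, conj_trivial]
    module
  have hB := curvature_bianchi_second hX hY hV hZ x
  have swap : ∀ B : Π x : M, TangentSpace I x, CMDiff ∞ (T% B) →
      cov B (curvature (I := I) Y V Z) x - curvature (I := I) Y V (cov B Z) x =
        -(cov B (curvature (I := I) V Y Z) x - curvature (I := I) V Y (cov B Z) x) := by
    intro B hB
    have h : curvature (I := I) Y V Z = - curvature (I := I) V Y Z :=
      funext fun y ↦ curvature_swap Y V Z y
    rw [h, cov_neg (contMDiff_curvature hV hY hZ), curvature_swap Y V (cov B Z)]
    abel
  -- As `[Y,V] = -f Y - ∇_V Y`, this bracket term contributes `-f R(X,Y)Z`; with the same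
  -- contribution from `[V,X]`, this is the source of the factor `2f`.
  have e1 : curvature (I := I) X (mlieBracket I Y V) Z x =
      -(f x • curvatureAt x (X x) (Y x) (Z x)) - curvatureAt x (X x) (cov V Y x) (Z x) := by
    rw [← curvatureAt_eq hX (contMDiff_mlieBracket hY hV) hZ, ← cov_sub_cov hY hV, hcV Y,
      show -(f x • Y x) - cov V Y x = (-f x) • Y x + (-1 : ℝ) • cov V Y x by module,
      curvatureAt_add_mid, curvatureAt_smul_mid, curvatureAt_smul_mid]
    module
  have e2 : curvature (I := I) Y (mlieBracket I V X) Z x =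
      -(f x • curvatureAt x (X x) (Y x) (Z x)) - curvatureAt x (cov V X x) (Y x) (Z x) := by
    rw [← curvatureAt_eq hY (contMDiff_mlieBracket hV hX) hZ, ← cov_sub_cov hV hX, hcV X,
      show cov V X x - -(f x • X x) = (f x) • X x + cov V X x by module,
      curvatureAt_swap, curvatureAt_add_left, curvatureAt_smul_left]
    module
  rw [swap X hX, covleft hY hX, covleft hX hY, e1, e2, left (contMDiff_mlieBracket hX hY) hZ,
    ← cov_sub_cov hX hY, inner_sub_left, ← curvatureAt_eq hX hY (contMDiff_cov hV hZ)] at hB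
  rw [← sub_eq_zero, ← hB]
  module

/-! ### Scalar curvature along the gradient, and the Einstein condition. -/

/-- The scalar curvature. -/
def scalarCurvature (x : M) : ℝ := metricTrace (ricci (I := I) x)

/-- The Ricci tensor as a bilinear map. -/
def ricciForm (x : M) : TangentSpace I x →ₗ[ℝ] TangentSpace I x →ₗ[ℝ] ℝ :=
  LinearMap.mk₂ ℝ (ricci x) ricci_add_left ricci_smul_left
    (fun v w w' ↦ by rw [ricci_comm, ricci_add_left, ricci_comm w, ricci_comm w'])
    (fun c v w ↦ by rw [ricci_comm, ricci_smul_left, ricci_comm w]; rfl)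

theorem scalarCurvature_eq_sum {e : Fin (Module.finrank ℝ E) → TangentSpace I x}
    (he : Orthonormal ℝ e) : scalarCurvature (I := I) x = ∑ j, ricci x (e j) (e j) :=
  metricTrace_eq_sum he (ricciForm x)

theorem scalarCurvature_eq_sum_curvature {e : Fin (Module.finrank ℝ E) → Π x : M, TangentSpace I x}
    (hs : ∀ i, CMDiff ∞ (T% (e i))) (he : Orthonormal ℝ (fun i ↦ e i x)) :
    scalarCurvature (I := I) x =
      ∑ j, ∑ i, inner ℝ (curvature (I := I) (e i) (e j) (e j) x) (e i x) := by
  rw [scalarCurvature_eq_sum he]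
  refine Finset.sum_congr rfl fun j _ ↦ ?_
  rw [ricci_eq_sum he]
  refine Finset.sum_congr rfl fun i _ ↦ ?_
  rw [curvatureAt_eq (hs i) (hs j) (hs j)]

theorem contMDiff_scalarCurvature : CMDiff ∞ (scalarCurvature (I := I) (M := M)) := by
  intro x
  obtain ⟨e, he, heo⟩ := exists_orthonormal_frame (I := I) x
  have h : CMDiff ∞ (fun y : M ↦
      ∑ j, ∑ i, inner ℝ (curvature (I := I) (e i) (e j) (e j) y) (e i y)) :=
    contMDiff_finsetSum fun j _ ↦ contMDiff_finsetSum fun i _ ↦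
      contMDiff_inner (contMDiff_curvature (he i) (he j) (he j)) (he i)
  refine (h x).congr_of_eventuallyEq ?_
  filter_upwards [heo] with y hy using scalarCurvature_eq_sum_curvature he hy

/-- The double trace of `∇_V R = 2f (R - R₁)`. Derivatives of the frame drop out of both traces by
skewness. -/
theorem dir_gradient_scalarCurvature (hf : CMDiff ∞ f)
    (hHess : ∀ (x : M) (v : TangentSpace I x), leviCivita I M (gradient I f) x v = -(f x • v))
    (x : M) : dir (gradient I f) (scalarCurvature (I := I)) x =
      2 * f x * (scalarCurvature (I := I) x -
        (Module.finrank ℝ E : ℝ) * ((Module.finrank ℝ E : ℝ) - 1)) := by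
  obtain ⟨e, he, heo⟩ := exists_orthonormal_frame (I := I) x
  have hex := heo.self_of_nhds
  have hV := contMDiff_gradient hf
  set V := gradient I f with hVdef
  have hR : ∀ i j, CMDiff ∞ (T% (curvature (I := I) (e i) (e j) (e j))) := fun i j ↦
    contMDiff_curvature (he i) (he j) (he j)
  have hskew := inner_cov_frame_skew hV he heo
  rw [dir_congr (g := fun y : M ↦ ∑ j, ∑ i, inner ℝ (curvature (I := I) (e i) (e j) (e j) y) (e i y))
    (heo.mono fun y hy ↦ scalarCurvature_eq_sum_curvature he hy),
    dir_sum _ fun j ↦ contMDiff_finsetSum fun i _ ↦ contMDiff_inner (hR i j) (he i)]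
  have hij : ∀ i j, (inner ℝ (e i x) (e j x) : ℝ) = if i = j then 1 else 0 :=
    orthonormal_iff_ite.1 hex
  have term : ∀ j, dir V (fun y : M ↦
      ∑ i, inner ℝ (curvature (I := I) (e i) (e j) (e j) y) (e i y)) x =
      (ricci x (cov V (e j) x) (e j x) + ricci x (e j x) (cov V (e j) x)) +
        2 * f x * (ricci x (e j x) (e j x) - ((Module.finrank ℝ E : ℝ) - 1)) := by
    intro j
    rw [dir_sum _ fun i ↦ contMDiff_inner (hR i j) (he i)]
    -- The entry `1 - δᵢⱼ` is the sectional term of the unit sphere; summed over `i` it gives `n -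
    -- 1`.
    have h1 : ∀ i, dir V (fun y : M ↦ inner ℝ (curvature (I := I) (e i) (e j) (e j) y) (e i y)) x =
        inner ℝ (curvatureAt x (e i x) (cov V (e j) x) (e j x)) (e i x)
        + inner ℝ (curvatureAt x (e i x) (e j x) (cov V (e j) x)) (e i x)
        + (curvatureForm x (e j x) (e j x) (cov V (e i) x) (e i x)
          + curvatureForm x (e j x) (e j x) (e i x) (cov V (e i) x))
        + 2 * f x * (inner ℝ (curvatureAt x (e i x) (e j x) (e j x)) (e i x)
          - (1 - if i = j then 1 else 0)) := by
      intro i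
      rw [dir_inner hV (hR i j) (he i), cov_gradient_curvature hf hHess (he i) (he j) (he j),
        ← curvatureAt_eq (he i) (he j) (he j)]
      change _ = _ + _ + (inner ℝ (curvatureAt x (cov V (e i) x) (e j x) (e j x)) (e i x) +
        inner ℝ (curvatureAt x (e i x) (e j x) (e j x)) (cov V (e i) x)) + _
      simp only [inner_add_left, inner_sub_left, inner_smul_left, hij, conj_trivial, if_true,
        ← hVdef]
      rw [show (if j = i then (1 : ℝ) else 0) = if i = j then 1 else 0 by simp only [eq_comm]]
      split_ifs <;> ring
    simp only [h1, Finset.sum_add_distrib, ← Finset.mul_sum, Finset.sum_sub_distrib]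
    have h2 := sum_bilin_skew hex (card_fin_finrank x) hskew (curvatureForm x (e j x) (e j x))
    rw [Finset.sum_add_distrib] at h2
    rw [h2, ricci_eq_sum hex, ricci_eq_sum hex, ricci_eq_sum hex]
    simp
  have h3 := sum_bilin_skew hex (card_fin_finrank x) hskew (ricciForm x)
  have h3' : ∑ j, (ricci x (cov V (e j) x) (e j x) + ricci x (e j x) (cov V (e j) x)) = 0 := h3
  simp only [term]
  rw [Finset.sum_add_distrib, h3', scalarCurvature_eq_sum hex, ← Finset.mul_sum,
    Finset.sum_sub_distrib]
  simp only [Finset.sum_const, Finset.card_univ, Fintype.card_fin, nsmul_eq_mul]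
  ring

/-- On a closed manifold with `Ric ≥ (n - 1) g`, a nontrivial solution of `∇²f = -f g` forces
`Ric = (n - 1) g`. -/
theorem ricci_eq_of_hessian_eq [I.Boundaryless] [CompactSpace M] [Nonempty M]
    (hRic : ∀ (x : M) (v : TangentSpace I x),
      ((Module.finrank ℝ E : ℝ) - 1) * inner ℝ v v ≤ ricci x v v)
    (hf : CMDiff ∞ f) (hf0 : f ≠ 0)
    (hHess : ∀ (x : M) (v : TangentSpace I x), leviCivita I M (gradient I f) x v = -(f x • v))
    {c : ℝ} (hc : ∀ x : M, inner ℝ (gradient I f x) (gradient I f x) + f x * f x = c)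
    (x : M) (v w : TangentSpace I x) :
    ricci x v w = ((Module.finrank ℝ E : ℝ) - 1) * inner ℝ v w := by
  -- Dimension zero is separate: below, a nonzero tangent vector is needed to deduce `f x = 0` from
  -- `f x • a = 0`.
  rcases subsingleton_or_nontrivial (TangentSpace I x) with hsub | hnt
  · have h := ricci_smul_left (0 : ℝ) v w
    rw [zero_smul, zero_mul, ← Subsingleton.elim v 0] at h
    rw [h, Subsingleton.elim v 0, inner_zero_left, mul_zero]
  set n : ℝ := (Module.finrank ℝ E : ℝ) with hn
  have hV := contMDiff_gradient hf
  set V := gradient I f with hVdef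
  let s : M → ℝ := fun y ↦ scalarCurvature (I := I) y - n * (n - 1)
  have hconst : ∀ a : ℝ, CMDiff ∞ (fun _ : M ↦ a) := fun a ↦ contMDiff_const
  have hs : CMDiff ∞ s := contMDiff_scalarCurvature.sub (hconst _)
  have hdirs : ∀ y, dir V s y = 2 * f y * s y := fun y ↦ by
    rw [dir_sub contMDiff_scalarCurvature (hconst _), dir_const, sub_zero]
    exact dir_gradient_scalarCurvature hf hHess y
  have hsnn : ∀ y, 0 ≤ s y := by
    intro y
    obtain ⟨e, he, heo⟩ := exists_orthonormal_frame (I := I) y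
    have hey := heo.self_of_nhds
    have h1 : ∀ j, n - 1 ≤ ricci y (e j y) (e j y) := fun j ↦ by
      have := hRic y (e j y)
      rwa [real_inner_self_eq_norm_sq, hey.1 j, one_pow, mul_one] at this
    have h2 := Finset.sum_le_sum fun j (_ : j ∈ Finset.univ) ↦ h1 j
    rw [← scalarCurvature_eq_sum hey] at h2
    simp only [Finset.sum_const, Finset.card_univ, Fintype.card_fin, nsmul_eq_mul, ← hn] at h2
    exact sub_nonneg.2 h2
  have hVc : ∀ y, c - f y * f y = inner ℝ (V y) (V y) := fun y ↦ by rw [← hc y]; ring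
  have hdirf : ∀ y, dir V f y = c - f y * f y := fun y ↦ by
    rw [dir_eq_inner_gradient, hVc]
  let p : M → ℝ := fun y ↦ c - f y * f y
  have hff : CMDiff ∞ (fun y : M ↦ f y * f y) := hf.mul hf
  have hp : CMDiff ∞ p := (hconst c).sub hff
  let q : M → ℝ := fun y ↦ Real.exp (f y)
  have hq : CMDiff ∞ q := contMDiff_real_comp Real.contDiff_exp hf
  have hsp : CMDiff ∞ (fun y ↦ s y * p y) := hs.mul hp
  -- Here `p = |V|²`, and `s p` is constant along `V`. The factor `e^f`, increasing along `V`, makes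
  -- `VΨ` strictly positive wherever `Ψ > 0`, which rules out a positive maximum.
  let Ψ : M → ℝ := fun y ↦ s y * p y * q y
  have hΨ : CMDiff ∞ Ψ := hsp.mul hq
  have hdirΨ : ∀ y, dir V Ψ y = s y * (c - f y * f y) ^ 2 * Real.exp (f y) := by
    intro y
    have h1 : dir V p y = - (2 * f y * (c - f y * f y)) := by
      rw [dir_sub (hconst c) hff, dir_const, dir_mul hf hf, hdirf]
      ring
    have h2 : dir V q y = Real.exp (f y) * (c - f y * f y) := by
      rw [dir_comp (Real.hasDerivAt_exp (f y)) hf, hdirf]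
    rw [dir_mul hsp hq, dir_mul hs hp, h1, h2, hdirs]
    simp only [p, q]
    ring
  obtain ⟨m, -, hm⟩ := isCompact_univ.exists_isMaxOn (univ_nonempty (α := M))
    hΨ.continuous.continuousOn
  have hmax : IsLocalMax Ψ m := Eventually.of_forall fun y ↦ hm (mem_univ y)
  have hm0 := dir_eq_zero_of_isLocalMax hΨ hV hmax
  rw [hdirΨ m] at hm0
  have hΨm : Ψ m = 0 := by
    have h1 : s m * (c - f m * f m) ^ 2 = 0 := (mul_eq_zero.1 hm0).resolve_right (Real.exp_ne_zero _)
    have h2 : s m * (c - f m * f m) = 0 := by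
      rcases mul_eq_zero.1 h1 with h | h
      · rw [h, zero_mul]
      · rw [pow_eq_zero_iff two_ne_zero] at h
        rw [h, mul_zero]
    simp only [Ψ, p, h2, zero_mul]
  have hsV : ∀ y, V y ≠ 0 → s y = 0 := by
    intro y hy
    have h1 : Ψ y ≤ 0 := hΨm ▸ (hm (mem_univ y) : Ψ y ≤ Ψ m)
    have h2 : 0 < p y := by
      simp only [p, hVc]
      exact real_inner_self_pos.2 hy
    by_contra hne
    have h3 : 0 < s y := lt_of_le_of_ne (hsnn y) (Ne.symm hne)
    have h4 : 0 < Ψ y := mul_pos (mul_pos h3 h2) (Real.exp_pos _)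
    linarith
  -- If `s x ≠ 0`, then `V = 0` near `x`, so `∇V = 0` and `f x = 0`. Hence `c = 0`, and `f` vanishes
  -- identically.
  have hsx : s x = 0 := by
    by_contra hne
    have h1 : ∀ᶠ y in 𝓝 x, V y = 0 := by
      filter_upwards [hs.continuous.continuousAt.eventually_ne hne] with y hy
      by_contra h
      exact hy (hsV y h)
    obtain ⟨a, ha⟩ := exists_ne (0 : TangentSpace I x)
    obtain ⟨A, hA, -, rfl⟩ := exists_contMDiff_eq (I := I) a
    have hzero : CMDiff ∞ (T% (0 : Π x : M, TangentSpace I x)) := contMDiff_zeroSection _ _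
    have h2 : cov A V x = cov A 0 x :=
      cov_congr (mdiffAt_of_contMDiff hV x) (mdiffAt_of_contMDiff hzero x) h1 rfl
    have h3 : cov A (0 : Π x : M, TangentSpace I x) x = 0 := by
      have := cov_smul (X := A) (hconst 0) hzero x
      rw [dir_const, zero_smul, zero_smul, zero_add] at this
      rw [← this, smul_zero]
    have h4 : -(f x • A x) = 0 := (hHess x (A x)).symm.trans (h2.trans h3)
    have h5 : f x = 0 := (smul_eq_zero.1 (neg_eq_zero.1 h4)).resolve_right ha
    have h6 : c = 0 := by
      rw [← hc x, h1.self_of_nhds, h5]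
      simp
    apply hf0
    funext y
    have h7 := hc y
    have h8 : 0 ≤ inner ℝ (V y) (V y) := real_inner_self_nonneg
    have h9 : f y * f y = 0 := le_antisymm (by linarith) (mul_self_nonneg _)
    exact mul_self_eq_zero.1 h9
  obtain ⟨e, he, heo⟩ := exists_orthonormal_frame (I := I) x
  have hex := heo.self_of_nhds
  have hB := bilin_eq_zero_of_trace_eq_zero hex (card_fin_finrank x)
    (ricciForm x - (n - 1) • innerₗ (TangentSpace I x))
    (fun v w ↦ by
      change ricci x v w - (n - 1) * inner ℝ v w = ricci x w v - (n - 1) * inner ℝ w v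
      rw [ricci_comm, real_inner_comm])
    (fun v ↦ by
      change 0 ≤ ricci x v v - (n - 1) * inner ℝ v v
      linarith [hRic x v])
    (by
      change ∑ i, (ricci x (e i x) (e i x) - (n - 1) * inner ℝ (e i x) (e i x)) = 0
      have h1 : ∀ i, (inner ℝ (e i x) (e i x) : ℝ) = 1 := fun i ↦ by
        rw [real_inner_self_eq_norm_sq, hex.1 i, one_pow]
      simp only [h1, Finset.sum_sub_distrib, ← scalarCurvature_eq_sum hex, Finset.sum_const,
        Finset.card_univ, Fintype.card_fin, nsmul_eq_mul, mul_one, ← hn]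
      have h2 : scalarCurvature (I := I) x - n * (n - 1) = 0 := hsx
      linarith) v w
  change ricci x v w - (n - 1) * inner ℝ v w = 0 at hB
  linarith

end

end RiemannianGeometry

end

theorem proposition2 (n : ℕ)
    {M : Type*} [TopologicalSpace M] [T2Space M] [CompactSpace M] [ConnectedSpace M]
    [ChartedSpace (EuclideanSpace ℝ (Fin n)) M] [IsManifold (𝓡 n) ∞ M]
    [RiemannianBundle (fun x : M ↦ TangentSpace (𝓡 n) x)]
    [IsContMDiffRiemannianBundle (𝓡 n) ∞ (EuclideanSpace ℝ (Fin n))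
      (fun x : M ↦ TangentSpace (𝓡 n) x)]
    (hRic : ∀ (x : M) (v : TangentSpace (𝓡 n) x),
      ((n : ℝ) - 1) * inner ℝ v v ≤ RiemannianGeometry.ricci x v v)
    (f : M → ℝ) (hf : ContMDiff (𝓡 n) 𝓘(ℝ, ℝ) ∞ f) (hf0 : f ≠ 0)
    (hΔ : ∀ x : M, RiemannianGeometry.laplacian (𝓡 n) f x = (n : ℝ) * f x) :
    RiemannianGeometry.IsEinstein (𝓡 n) M := by
  have hd : (Module.finrank ℝ (EuclideanSpace ℝ (Fin n)) : ℝ) = n := by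
    rw [finrank_euclideanSpace_fin]
  rw [← hd] at hRic
  simp only [← hd] at hΔ
  obtain ⟨hHess, c, hc⟩ := RiemannianGeometry.hessian_rigidity hRic hf hΔ
  -- The Einstein constant is `n - 1`, written with `Module.finrank`.
  exact ⟨_, RiemannianGeometry.ricci_eq_of_hessian_eq hRic hf hf0 hHess hc⟩
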